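/- Conventions. $\mathfrak M^+(0,\infty)$ is the set of all measurable functions $(0,\infty)\to[0,\infty]$, and $0\cdot\infty=0$, $0^{-1}=\infty$. A weight is a $v\in\mathfrak M^+(0,\infty)$ with $0<\int_0^x v<\infty$ for all $x\in(0,\infty)$. For a weight $v$ and $0\le x\le y\le\infty$ put $\sigma_p(x,y)=\big(\int_x^y v^{1-p'}\big)^{1/p'}$, $p'=\frac{p}{p-1}$, if $1<p<\infty$, and $\sigma_1(x,y)=\operatorname{ess\,sup}_{x<t<y}v(t)^{-1}$ (with $\sigma_p(x,x)=0$). A covering sequence $\{x_k\}_{k\in\mathcal Z}$ of a weight $u$ is the following. If $\int_0^\infty u=\infty$, then $\mathcal Z=\mathbb Z$ and $\{x_k\}\subset(0,\infty)$ is strictly increasing with $\int_0^{x_k}u=2^k$ for all $k$. If $\int_0^\infty u<\infty$, let $M\in\mathbb Z$ satisfy $2^M\le\int_0^\infty u<2^{M+1}$; then $\mathcal Z=\{k\in\mathbb Z:k\le M\}$, $\{x_k\}_{k\le M}\subset(0,\infty]$ is strictly increasing with $\int_0^{x_k}u=2^k$ for $k\le M$, and $x_{M+1}:=\infty$. For $a_k\in[0,\infty]$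 write $\|\{a_k\}\|_{\ell^s(\mathcal Z)}=\big(\sum_{k\in\mathcal Z}a_k^s\big)^{1/s}$ for $0<s<\infty$ and $\|\{a_k\}\|_{\ell^\infty(\mathcal Z)}=\sup_{k\in\mathcal Z}a_k$. **Lemma 5.1.** Let $1\le p<\infty$, $0<q,r<\infty$, let $u,v,w$ be weights on $(0,\infty)$, let $\{x_k\}_{k\in\mathcal Z}$ be a covering sequence of $u$, and let $\rho\in(0,\infty]$ be given by $\frac1\rho=\big(\frac1r-\frac1p\big)_+$ (so $\rho=\infty$ when $p\le r$). Consider the inequality $$\bigg\|\bigg\{2^{k/r}\bigg(\int_{x_k}^{x_{k+1}}\bigg(\int_{x_k}^t h\bigg)^q w(t)\,dt\bigg)^{1/q}\bigg\}\bigg\|_{\ell^r(\mathcal Z)}\le C\,\bigg\|\bigg\{\bigg(\int_{x_n}^{x_{n+1}}h^p v\bigg)^{1/p}\bigg\}\bigg\|_{\ell^p(\mathcal Z)},\qquad h\in\mathfrak M^+(0,\infty).\tag{1.5}$$ (i) If $p\le q$, then (1.5) holds for some constant $C<\infty$ independent of $h$ if and only if $A_1<\infty$, where $$A_1:=\bigg\|\bigg\{2^{k/r}\operatorname*{ess\,sup}_{x\in[x_k,x_{k+1})}\bigg(\int_x^{x_{k+1}}w\bigg)^{1/q}\sigma_p(x_k,x)\bigg\}\bigg\|_{\ell^\rho(\mathcal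 Z)}.$$ Moreover, the best (infimal) constant $C\in[0,\infty]$ in (1.5) satisfies $c_1A_1\le C\le c_2A_1$ with constants $0<c_1,c_2<\infty$ depending only on $p,q,r$. (ii) If $q<p$, then (1.5) holds for some constant $C<\infty$ independent of $h$ if and only if $A_2<\infty$, where $$A_2:=\bigg\|\bigg\{2^{k/r}\bigg(\int_{x_k}^{x_{k+1}}\bigg(\int_x^{x_{k+1}}w\bigg)^{\frac q{p-q}}w(x)\,[\sigma_p(x_k,x)]^{\frac{pq}{p-q}}\,dx\bigg)^{\frac{p-q}{pq}}\bigg\}\bigg\|_{\ell^\rho(\mathcal Z)}.$$ Moreover, the best (infimal) constant $C\in[0,\infty]$ in (1.5) satisfies $c_1A_2\le C\le c_2A_2$ with constants $0<c_1,c_2<\infty$ depending only on $p,q,r$. -/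

import Mathlib

open MeasureTheory Set
open scoped ENNReal NNReal

noncomputable section

/-- The integral `∫_a^b f` over `(a, b) ⊆ ℝ`, for extended real endpoints `a`, `b`. -/
def intE (f : ℝ → ℝ≥0∞) (a b : EReal) : ℝ≥0∞ :=
  ∫⁻ t in {t : ℝ | a < (t : EReal) ∧ (t : EReal) < b}, f t

/-- `f ∈ 𝔐⁺(0,∞)`: a Lebesgue measurable function on `(0,∞)` with values in `[0,∞]`.
The values of `f` outside `(0,∞)` are never used. -/
def IsMPos (f : ℝ → ℝ≥0∞) : Prop :=
  AEMeasurable f (volume.restrict (Ioi (0 : ℝ)))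

/-- `v` is a weight on `(0,∞)`: `v ∈ 𝔐⁺(0,∞)` and `0 < ∫_0^x v < ∞` for all `x ∈ (0,∞)`. -/
def IsWeight (v : ℝ → ℝ≥0∞) : Prop :=
  IsMPos v ∧ ∀ x : ℝ, 0 < x → 0 < intE v 0 x ∧ intE v 0 x < ⊤

/-- `σ_p(a,b)`: equal to `(∫_a^b v^{1-p'})^{1/p'}`, `p' = p/(p-1)`, for `1 < p < ∞`, and to
`ess sup_{a<t<b} v(t)⁻¹` for `p = 1`. -/
def sigmaP (p : ℝ) (v : ℝ → ℝ≥0∞) (a b : EReal) : ℝ≥0∞ :=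
  if p = 1 then
    essSup (fun t : ℝ => (v t)⁻¹)
      (volume.restrict {t : ℝ | a < (t : EReal) ∧ (t : EReal) < b})
  else
    (intE (fun t => v t ^ (1 - p / (p - 1))) a b) ^ (1 / (p / (p - 1)))

/-- `{x_k}_{k ∈ Z}` is a covering sequence for `u`, with index set `Z`.
If `∫_0^∞ u = ∞`, then `Z = ℤ` and `x` is a strictly increasing sequence in `(0,∞)` with
`∫_0^{x_k} u = 2^k`. Otherwise `Z = {k ≤ M}`, where `2^M ≤ ∫_0^∞ u < 2^{M+1}`, `x_{M+1} = ∞`, and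
`{x_k}_{k ≤ M}` is strictly increasing with `∫_0^{x_k} u = 2^k`. (The value `x_M = ∞` is not
excluded: it is forced if `∫_0^∞ u = 2^M` and `∫_0^x u < 2^M` for every finite `x`.) -/
def IsCoveringSequence (u : ℝ → ℝ≥0∞) (Z : Set ℤ) (x : ℤ → EReal) : Prop :=
  (intE u 0 ⊤ = ⊤ ∧ Z = univ ∧ StrictMono x ∧
    ∀ k : ℤ, 0 < x k ∧ x k < ⊤ ∧ intE u 0 (x k) = (2 : ℝ≥0∞) ^ k) ∨
  (∃ M : ℤ, (2 : ℝ≥0∞) ^ M ≤ intE u 0 ⊤ ∧ intE u 0 ⊤ < (2 : ℝ≥0∞) ^ (M + 1) ∧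
    Z = Iic M ∧ x (M + 1) = ⊤ ∧ StrictMonoOn x (Iic M) ∧
    ∀ k : ℤ, k ≤ M → 0 < x k ∧ intE u 0 (x k) = (2 : ℝ≥0∞) ^ k)

/-- The `ℓ^s(Z)` (quasi-)norm of a sequence with values in `[0,∞]`, `0 < s ≤ ∞`. -/
def ellNorm (s : ℝ≥0∞) (Z : Set ℤ) (a : ℤ → ℝ≥0∞) : ℝ≥0∞ :=
  if s = ⊤ then ⨆ k ∈ Z, a k
  else (∑' k : Z, a k ^ s.toReal) ^ (1 / s.toReal)

/-- The exponent `ρ ∈ (0,∞]` with `1/ρ = (1/r - 1/p)_+`. -/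
def rhoExp (p r : ℝ) : ℝ≥0∞ := (ENNReal.ofReal (1 / r - 1 / p))⁻¹

/-- The discrete inequality with constant `C`, for all `h ∈ 𝔐⁺(0,∞)`. -/
def DiscreteIneq (p q r : ℝ) (v w : ℝ → ℝ≥0∞) (Z : Set ℤ) (x : ℤ → EReal) (C : ℝ≥0∞) : Prop :=
  ∀ h : ℝ → ℝ≥0∞, IsMPos h →
    ellNorm (ENNReal.ofReal r) Z (fun k => (2 : ℝ≥0∞) ^ ((k : ℝ) / r) *
        (intE (fun t => (intE h (x k) t) ^ q * w t) (x k) (x (k + 1))) ^ (1 / q)) ≤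
      C * ellNorm (ENNReal.ofReal p) Z (fun n =>
        (intE (fun t => h t ^ p * v t) (x n) (x (n + 1))) ^ (1 / p))

/-- The best constant in the discrete inequality (`∞` if it holds with no finite constant). -/
def bestConst (p q r : ℝ) (v w : ℝ → ℝ≥0∞) (Z : Set ℤ) (x : ℤ → EReal) : ℝ≥0∞ :=
  sInf {C : ℝ≥0∞ | DiscreteIneq p q r v w Z x C}

/-- The quantity `A₁`. -/
def constA1 (p q r : ℝ) (v w : ℝ → ℝ≥0∞) (Z : Set ℤ) (x : ℤ → EReal) : ℝ≥0∞ :=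
  ellNorm (rhoExp p r) Z (fun k => (2 : ℝ≥0∞) ^ ((k : ℝ) / r) *
    essSup (fun y : ℝ => (intE w y (x (k + 1))) ^ (1 / q) * sigmaP p v (x k) y)
      (volume.restrict {y : ℝ | x k ≤ (y : EReal) ∧ (y : EReal) < x (k + 1)}))

/-- The quantity `A₂`. -/
def constA2 (p q r : ℝ) (v w : ℝ → ℝ≥0∞) (Z : Set ℤ) (x : ℤ → EReal) : ℝ≥0∞ :=
  ellNorm (rhoExp p r) Z (fun k => (2 : ℝ≥0∞) ^ ((k : ℝ) / r) *
    (intE (fun y : ℝ => (intE w y (x (k + 1))) ^ (q / (p - q)) * w y *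
      (sigmaP p v (x k) y) ^ (p * q / (p - q))) (x k) (x (k + 1))) ^ ((p - q) / (p * q)))

end

/-!
The left side of the discrete inequality only involves the disjoint intervals `(x_k, x_{k+1})`, so
the problem splits into a weighted Hardy inequality on each interval and a diagonal embedding of
`ℓ^p` into `ℓ^r`.

*Diagonal embedding.* The best constant in `‖(a_i s_i)‖_{ℓ^q} ≤ C ‖a‖_{ℓ^p}` is
`gapNorm p q s`: the supremum of `s` if `p ≤ q`, and its `ℓ^{pq/(p-q)}` norm if `q < p`. The upper
bound is Hölder's inequality (`tsum_mul_rpow_le_gapNorm`), the lower bound comes from the extremal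
sequence (`gapNorm_le_of_forall`). It is used twice: for the sequence of intervals, with the
exponents `p, r`, and for dyadic level sets inside one interval, with the exponents `p, q`.

*Hardy inequality on one interval.* Let `μ` be Lebesgue measure on the interval, `ν = w dμ`,
`σ(t) = σ_p(a, t)`. For the upper bound, cut along the level sets `E_j = {2^j < H ≤ 2^{j+1}}` of
`H(t) = ∫_{s<t} h dμ`. If `E_j` is not empty, then `h` has mass at least `2^{j-1}` on
`E_{j-1}`, so Hölder's inequality gives
`2^{j-1} ≤ (∫_{E_{j-1}} h^p v)^{1/p} inf_{E_j} σ`, and the diagonal embedding with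
`s_j = inf_{E_j} σ · ν(E_j)^{1/q}` bounds `∫ H^q dν` (`lintegral_head_rpow_le`). The norm of `s` is
then controlled by `A₁` or `A₂`. For the lower bound with `p ≤ q`, functions concentrated to the
left of a single point suffice (`measure_tail_rpow_mul_dualNorm_le`); for `q < p` one cuts along the
dyadic level sets of the tail `t ↦ ν(t, ∞)` and superposes near-extremal functions of the duality
between `L^p(v)` and `σ`, with the coefficients of the diagonal embedding
(`lintegral_tail_rpow_mul_dualNorm_le`).

Both cuts rest on the fact that, for a measure without atoms, the set where the tail
`t ↦ ν(t, ∞)` is at most `c` has measure at most `c` (`measure_tail_le`), with equality if `ν` is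
finite and `c` is positive and below the supremum of the tail (`le_measure_tail`). No integration by
parts is needed, so the argument is the same for all exponents, `p = 1` and `q < 1` included.
-/

/-! ### Diagonal embeddings of sequence spaces -/

/-- The best constant in `‖(a_i s_i)‖_{ℓ^q} ≤ C ‖a‖_{ℓ^p}`: the `ℓ^ρ` norm of `s` with
`1/ρ = (1/q - 1/p)_+`. The exponent is written as `pq/(p-q)` for `q < p`. -/
noncomputable def gapNorm {ι : Type*} (p q : ℝ) (s : ι → ℝ≥0∞) : ℝ≥0∞ :=
  if p ≤ q then ⨆ i, s i else (∑' i, s i ^ (p * q / (p - q))) ^ ((p - q) / (p * q))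

theorem gapNorm_const_mul {ι : Type*} {p q : ℝ} (hp : 0 < p) (hq : 0 < q) (c : ℝ≥0∞)
    (s : ι → ℝ≥0∞) : gapNorm p q (fun i => c * s i) = c * gapNorm p q s := by
  unfold gapNorm
  split_ifs with hpq
  · exact (ENNReal.mul_iSup _ _).symm
  · have : 0 < p - q := by linarith
    have h1 : p * q / (p - q) * ((p - q) / (p * q)) = 1 := by field_simp
    simp_rw [ENNReal.mul_rpow_of_nonneg _ _ (show 0 ≤ p * q / (p - q) by positivity)]
    rw [ENNReal.tsum_mul_left, ENNReal.mul_rpow_of_nonneg _ _ (by positivity), ← ENNReal.rpow_mul,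
      h1, ENNReal.rpow_one]

theorem le_gapNorm {ι : Type*} {p q : ℝ} (hp : 0 < p) (hq : 0 < q) (s : ι → ℝ≥0∞) (i : ι) :
    s i ≤ gapNorm p q s := by
  unfold gapNorm
  split_ifs with hpq
  · exact le_iSup s i
  · have : 0 < p - q := by linarith
    have h1 : p * q / (p - q) * ((p - q) / (p * q)) = 1 := by field_simp
    calc s i = (s i ^ (p * q / (p - q))) ^ ((p - q) / (p * q)) := by
          rw [← ENNReal.rpow_mul, h1, ENNReal.rpow_one]
      _ ≤ _ := ENNReal.rpow_le_rpow
          (ENNReal.le_tsum (f := fun i => s i ^ (p * q / (p - q))) i) (by positivity)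

theorem tsum_rpow_le_of_exponent_le {ι : Type*} {p r : ℝ} (hp : 0 < p) (hpr : p ≤ r)
    (a : ι → ℝ≥0∞) : (∑' i, a i ^ r) ^ (1 / r) ≤ (∑' i, a i ^ p) ^ (1 / p) := by
  have hr : 0 < r := hp.trans_le hpr
  set N := (∑' i, a i ^ p) ^ (1 / p) with hN
  have hNp : ∑' i, a i ^ p = N ^ p := by
    rw [hN, ← ENNReal.rpow_mul, one_div_mul_cancel hp.ne', ENNReal.rpow_one]
  have hle : ∀ i, a i ≤ N := fun i => by
    rw [← ENNReal.rpow_le_rpow_iff hp, ← hNp]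
    exact ENNReal.le_tsum (f := fun i => a i ^ p) i
  have key : ∑' i, a i ^ r ≤ N ^ r := by
    calc ∑' i, a i ^ r ≤ ∑' i, a i ^ p * N ^ (r - p) := by
          refine ENNReal.tsum_le_tsum fun i => ?_
          calc a i ^ r = a i ^ p * a i ^ (r - p) := by
                rw [← ENNReal.rpow_add_of_nonneg _ _ hp.le (by linarith)]; congr 1; ring
            _ ≤ _ := by
              gcongr
              exact hle i
      _ = N ^ r := by
          rw [ENNReal.tsum_mul_right, hNp,
            ← ENNReal.rpow_add_of_nonneg _ _ hp.le (by linarith)]; congr 1; ring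
  calc _ ≤ (N ^ r) ^ (1 / r) := ENNReal.rpow_le_rpow key (by positivity)
    _ = N := by rw [← ENNReal.rpow_mul, mul_one_div_cancel hr.ne', ENNReal.rpow_one]

/-- Hölder's inequality for sequences, and the inclusion `ℓ^p ⊆ ℓ^q` if `p ≤ q`. -/
theorem tsum_mul_rpow_le_gapNorm {ι : Type*} {p q : ℝ} (hp : 0 < p) (hq : 0 < q)
    (a s : ι → ℝ≥0∞) :
    (∑' i, (a i * s i) ^ q) ^ (1 / q) ≤ gapNorm p q s * (∑' i, a i ^ p) ^ (1 / p) := by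
  unfold gapNorm
  split_ifs with hpq
  · calc (∑' i, (a i * s i) ^ q) ^ (1 / q)
        ≤ (∑' i, (a i * ⨆ i, s i) ^ q) ^ (1 / q) := by
          gcongr with i
          exact le_iSup s i
      _ = (⨆ i, s i) * (∑' i, a i ^ q) ^ (1 / q) := by
          simp_rw [ENNReal.mul_rpow_of_nonneg _ _ hq.le]
          rw [ENNReal.tsum_mul_right, ENNReal.mul_rpow_of_nonneg _ _ (by positivity),
            ← ENNReal.rpow_mul, mul_one_div_cancel hq.ne', ENNReal.rpow_one, mul_comm]
      _ ≤ _ := by gcongr; exact tsum_rpow_le_of_exponent_le hp hpq a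
  · have hd : 0 < p - q := by linarith
    have hconj : (p / q).HolderConjugate (p / (p - q)) := by
      rw [Real.holderConjugate_iff]
      refine ⟨by rw [lt_div_iff₀ hq]; linarith, by field_simp; ring⟩
    have key : ∑' i, (a i * s i) ^ q ≤
        (∑' i, a i ^ p) ^ (q / p) * (∑' i, s i ^ (p * q / (p - q))) ^ ((p - q) / p) := by
      rw [ENNReal.tsum_eq_iSup_sum]
      refine iSup_le fun F => ?_
      have h := ENNReal.inner_le_Lp_mul_Lq F (fun i => a i ^ q) (fun i => s i ^ q) hconj
      simp_rw [← ENNReal.rpow_mul] at h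
      have e1 : q * (p / q) = p := by field_simp
      have e2 : q * (p / (p - q)) = p * q / (p - q) := by field_simp
      have e3 : 1 / (p / q) = q / p := by field_simp
      have e4 : 1 / (p / (p - q)) = (p - q) / p := by field_simp
      rw [e1, e2, e3, e4] at h
      simp_rw [ENNReal.mul_rpow_of_nonneg _ _ hq.le]
      refine h.trans ?_
      gcongr <;> exact ENNReal.sum_le_tsum F
    calc _ ≤ ((∑' i, a i ^ p) ^ (q / p) * (∑' i, s i ^ (p * q / (p - q))) ^ ((p - q) / p)) ^ (1 / q)
          := by gcongr
      _ = _ := by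
        rw [ENNReal.mul_rpow_of_nonneg _ _ (by positivity), ← ENNReal.rpow_mul, ← ENNReal.rpow_mul,
          mul_comm]
        congr 2 <;> field_simp

/-- Converse of Hölder's inequality for sequences. It is enough to test on `l i < s i` in place of
`s i`, at the price of the factor `2`; this form suits sequences `s` whose members are suprema that
need not be attained. -/
theorem gapNorm_le_of_forall {ι : Type*} {p q : ℝ} (hp : 0 < p) (hq : 0 < q)
    (s : ι → ℝ≥0∞) (K : ℝ≥0∞)
    (H : ∀ l b : ι → ℝ≥0∞, (∀ i, l i < s i ∨ l i = 0) → ∑' i, b i ^ p ≤ 1 →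
      (∑' i, (b i * l i) ^ q) ^ (1 / q) ≤ K) :
    gapNorm p q s ≤ 2 * K := by
  classical
  -- Testing on one coordinate bounds every `s i` by `K`. Hence, for finite `K`, the sequence
  -- `l = s / 2` is admissible.
  have hs : ∀ i, s i ≤ K := by
    intro i
    refine le_of_forall_lt fun c hc => ?_
    obtain ⟨d, hcd, hd⟩ := exists_between hc
    refine hcd.trans_le ?_
    have h := H (Pi.single i d) (Pi.single i 1) (fun j => ?_) ?_
    · rw [tsum_eq_single i (fun j hj => by simp [hj, hq])] at h
      rwa [Pi.single_eq_same, Pi.single_eq_same, one_mul, ← ENNReal.rpow_mul,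
        mul_one_div_cancel hq.ne', ENNReal.rpow_one] at h
    · by_cases hj : j = i
      · subst hj; left; simpa using hd
      · right; simp [hj]
    · rw [tsum_eq_single i (fun j hj => by simp [hj, hp])]; simp
  have h2 : K ≤ 2 * K := by
    calc K = 1 * K := (one_mul K).symm
      _ ≤ 2 * K := by gcongr; norm_num
  unfold gapNorm
  split_ifs with hpq
  · exact (iSup_le hs).trans h2
  · rcases eq_or_ne K ⊤ with rfl | hK
    · simp
    have hd : 0 < p - q := by linarith
    set R := p * q / (p - q) with hR
    have hR0 : 0 < R := by positivity
    have hR1 : (p - q) / (p * q) = 1 / R := by rw [hR]; field_simp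
    have hst : ∀ i, s i ≠ ⊤ := fun i => ((hs i).trans_lt hK.lt_top).ne
    set l : ι → ℝ≥0∞ := fun i => s i / 2 with hl
    have hlt : ∀ i, l i ≠ ⊤ := fun i => ENNReal.div_ne_top (hst i) (by norm_num)
    have hls : ∀ i, l i < s i ∨ l i = 0 := by
      intro i
      by_cases h0 : s i = 0
      · right; simp [hl, h0]
      · left; exact ENNReal.half_lt_self h0 (hst i)
    have key : ∀ F : Finset ι, ∑ i ∈ F, l i ^ R ≤ K ^ R := by
      intro F
      set D := ∑ i ∈ F, l i ^ R with hD
      have hDt : D ≠ ⊤ := by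
        rw [hD]
        exact (ENNReal.sum_lt_top.2 fun i _ =>
          ENNReal.rpow_lt_top_of_nonneg hR0.le (hlt i)).ne
      by_cases hD0 : D = 0
      · rw [hD0]; exact zero_le
      -- The extremal sequence of Hölder's inequality on `F`, normalized in `ℓ^p`.
      set b : ι → ℝ≥0∞ := fun i => if i ∈ F then l i ^ (R / p) * D ^ (-(1 / p)) else 0 with hb
      -- Both `∑ b ^ p` and `∑ b ^ q * l ^ q` are multiples of `D`.
      have hsum : ∀ e f : ℝ, 0 < e → e * (R / p) + f = R → 0 ≤ f →
          ∑' i, b i ^ e * l i ^ f = D * D ^ (-(e / p)) := by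
        intro e f he hef hf
        rw [tsum_eq_sum (s := F) (fun i hi => by simp [hb, hi, he]), hD, Finset.sum_mul]
        refine Finset.sum_congr rfl fun i hi => ?_
        simp only [hb, hi, if_true]
        rw [ENNReal.mul_rpow_of_nonneg _ _ he.le, ← ENNReal.rpow_mul, ← ENNReal.rpow_mul,
          mul_right_comm, ← ENNReal.rpow_add_of_nonneg _ _ (by positivity) hf]
        congr 2
        · rw [mul_comm (R / p) e, hef]
        · ring
      have hb1 : ∑' i, b i ^ p = 1 := by
        have h := hsum p 0 hp (by field_simp; ring) le_rfl
        simp only [ENNReal.rpow_zero, mul_one] at h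
        rw [h, div_self hp.ne', ENNReal.rpow_neg_one, ENNReal.mul_inv_cancel hD0 hDt]
      have hb2 := H l b hls hb1.le
      simp_rw [ENNReal.mul_rpow_of_nonneg _ _ hq.le] at hb2
      have hexp : q * (R / p) + q = R := by rw [hR]; field_simp; ring
      rw [hsum q q hq hexp hq.le] at hb2
      have hDD : D * D ^ (-(q / p)) = D ^ (q / R) := by
        nth_rw 1 [← ENNReal.rpow_one D]
        rw [← ENNReal.rpow_add _ _ hD0 hDt]
        congr 1
        rw [hR]; field_simp; ring
      rw [hDD, ← ENNReal.rpow_mul] at hb2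
      have e : q / R * (1 / q) = 1 / R := by field_simp
      rw [e] at hb2
      calc D = (D ^ (1 / R)) ^ R := by
            rw [← ENNReal.rpow_mul, one_div_mul_cancel hR0.ne', ENNReal.rpow_one]
        _ ≤ K ^ R := ENNReal.rpow_le_rpow hb2 hR0.le
    have hl2 : ∀ i, s i = 2 * l i := fun i => by
      rw [hl]; exact (ENNReal.mul_div_cancel (by norm_num) (by norm_num)).symm
    rw [hR1]
    calc (∑' i, s i ^ R) ^ (1 / R) = (2 ^ R * ∑' i, l i ^ R) ^ (1 / R) := by
          rw [← ENNReal.tsum_mul_left]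
          congr 2; ext i
          rw [hl2 i, ENNReal.mul_rpow_of_nonneg _ _ hR0.le]
      _ ≤ (2 ^ R * K ^ R) ^ (1 / R) := by
          gcongr
          rw [ENNReal.tsum_eq_iSup_sum]
          exact iSup_le key
      _ = 2 * K := by
          rw [← ENNReal.mul_rpow_of_nonneg _ _ hR0.le, ← ENNReal.rpow_mul,
            mul_one_div_cancel hR0.ne', ENNReal.rpow_one]

theorem ellNorm_ofReal {r : ℝ} (hr : 0 < r) (Z : Set ℤ) (a : ℤ → ℝ≥0∞) :
    ellNorm (ENNReal.ofReal r) Z a = (∑' k : Z, a k ^ r) ^ (1 / r) := by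
  simp [ellNorm, ENNReal.toReal_ofReal hr.le]

theorem ellNorm_rhoExp {p r : ℝ} (hp : 0 < p) (hr : 0 < r) (Z : Set ℤ) (a : ℤ → ℝ≥0∞) :
    ellNorm (rhoExp p r) Z a = gapNorm p r (fun k : Z => a k) := by
  unfold ellNorm gapNorm rhoExp
  by_cases h : p ≤ r
  · have : 1 / r - 1 / p ≤ 0 := by
      have := one_div_le_one_div_of_le hp h
      linarith
    rw [ENNReal.ofReal_of_nonpos this]
    simp [h, iSup_subtype']
  · have hd : 0 < p - r := by linarith
    have e : 1 / r - 1 / p = (p - r) / (p * r) := by field_simp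
    have : 0 < (p - r) / (p * r) := by positivity
    rw [e, ← ENNReal.ofReal_inv_of_pos this, if_neg ENNReal.ofReal_ne_top, if_neg h,
      ENNReal.toReal_ofReal (by positivity)]
    simp [inv_div]

/-! ### Tails of measures without atoms, and dyadic level sets -/

/-- The set `{s | ν (Ioi s) ≤ c}` is an upper set, hence a half-line up to its end point, and its
measure is a supremum of tails `ν (Ioi s) ≤ c`. -/
theorem measure_tail_le (ν : Measure ℝ) [NullSingletonClass ν] (c : ℝ≥0∞) :
    ν {s | ν (Ioi s) ≤ c} ≤ c := by
  set U : Set ℝ := {s | ν (Ioi s) ≤ c} with hU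
  rcases U.eq_empty_or_nonempty with h0 | hne
  · simp [h0]
  by_cases hb : BddBelow U
  · obtain ⟨u, hua, hut, huU⟩ := exists_seq_tendsto_sInf hne hb
    have h1 : U ⊆ Ici (sInf U) := fun s hs => csInf_le hb hs
    refine (measure_mono h1).trans ?_
    rw [← measure_congr (Ioi_ae_eq_Ici (μ := ν) (a := sInf U))]
    have h2 : Ioi (sInf U) ⊆ ⋃ n, Ioi (u n) := fun y hy => by
      simpa using (hut.eventually_lt_const hy).exists
    refine (measure_mono h2).trans ?_
    rw [Monotone.measure_iUnion (fun m n hmn => Ioi_subset_Ioi (hua hmn))]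
    exact iSup_le fun n => huU n
  · have h2 : U ⊆ ⋃ n : ℕ, Ioi (-(n : ℝ)) := fun y _ => by
      obtain ⟨n, hn⟩ := exists_nat_gt (-y)
      exact mem_iUnion.2 ⟨n, by simp only [mem_Ioi]; linarith⟩
    refine (measure_mono h2).trans ?_
    rw [Monotone.measure_iUnion (fun m n hmn => Ioi_subset_Ioi (by simpa using hmn))]
    refine iSup_le fun n => ?_
    rw [not_bddBelow_iff] at hb
    obtain ⟨s, hs, hsn⟩ := hb (-(n : ℝ))
    exact (measure_mono (Ioi_subset_Ioi hsn.le)).trans hs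

/-- If the tail takes values above `c`, then it is continuous at the end point of the half-line
`{s | ν (Ioi s) ≤ c}`, because `ν` is finite without atoms, and so takes the value `c` there. -/
theorem le_measure_tail (ν : Measure ℝ) [NullSingletonClass ν] [IsFiniteMeasure ν] {c : ℝ≥0∞}
    (hc : 0 < c) {t : ℝ} (ht : c < ν (Ioi t)) : c ≤ ν {s | ν (Ioi s) ≤ c} := by
  set U : Set ℝ := {s | ν (Ioi s) ≤ c} with hU
  have hanti : Antitone fun s => ν (Ioi s) := fun a b hab => measure_mono (Ioi_subset_Ioi hab)
  have hb : BddBelow U := ⟨t, fun s hs => by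
    by_contra! hst
    exact absurd (ht.trans_le (hanti hst.le)) (not_lt.2 hs)⟩
  have hne : U.Nonempty := by
    have h := tendsto_measure_iInter_atTop (μ := ν) (s := fun n : ℕ => Ioi (n : ℝ))
      (fun n => measurableSet_Ioi.nullMeasurableSet)
      (fun m n hmn => Ioi_subset_Ioi (by simpa using hmn)) ⟨0, measure_ne_top _ _⟩
    have h0 : ⋂ n : ℕ, Ioi (n : ℝ) = ∅ := by
      ext y
      obtain ⟨n, hn⟩ := exists_nat_gt y
      simpa using ⟨n, hn.le⟩
    rw [h0, measure_empty] at h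
    obtain ⟨n, hn⟩ := (h.eventually_lt_const hc).exists
    exact ⟨n, hn.le⟩
  have h1 : Ioi (sInf U) ⊆ U := fun s hs => by
    obtain ⟨y, hy, hys⟩ := exists_lt_of_csInf_lt hne hs
    exact (hanti hys.le).trans hy
  refine le_trans ?_ (measure_mono h1)
  rw [measure_congr (Ioi_ae_eq_Ici (μ := ν) (a := sInf U))]
  obtain ⟨u, hum, hlt, hut⟩ := exists_seq_strictMono_tendsto (sInf U)
  have h := tendsto_measure_iInter_atTop (μ := ν) (s := fun n : ℕ => Ioi (u n))
      (fun n => measurableSet_Ioi.nullMeasurableSet)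
      (fun m n hmn => Ioi_subset_Ioi (hum.monotone hmn)) ⟨0, measure_ne_top _ _⟩
  have h2 : ⋂ n : ℕ, Ioi (u n) = Ici (sInf U) := by
    ext y
    simp only [mem_iInter, mem_Ioi, mem_Ici]
    exact ⟨fun hy => le_of_tendsto' hut fun n => (hy n).le, fun hy n => (hlt n).trans_le hy⟩
  rw [h2] at h
  refine ge_of_tendsto' h fun n => ?_
  have : u n ∉ U := notMem_of_lt_csInf (hlt n) hb
  exact (not_le.1 this).le

theorem nullSingletonClass_map_neg (ν : Measure ℝ) [NullSingletonClass ν] :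
    NullSingletonClass (ν.map Neg.neg) :=
  ⟨fun x => by
    rw [Measure.map_apply measurable_neg (measurableSet_singleton x)]
    simp⟩

theorem map_neg_Ioi (ν : Measure ℝ) (s : ℝ) : ν.map Neg.neg (Ioi s) = ν (Iio (-s)) := by
  rw [Measure.map_apply measurable_neg measurableSet_Ioi]; simp

theorem map_neg_tail (ν : Measure ℝ) (c : ℝ≥0∞) :
    ν.map Neg.neg {s | ν.map Neg.neg (Ioi s) ≤ c} = ν {s | ν (Iio s) ≤ c} := by
  have hm : MeasurableSet {s | ν.map Neg.neg (Ioi s) ≤ c} :=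
    measurableSet_le (Antitone.measurable fun a b hab => measure_mono (Ioi_subset_Ioi hab))
      measurable_const
  rw [Measure.map_apply measurable_neg hm]
  congr 1
  ext s
  simp [map_neg_Ioi]

/-- The mirror image of `measure_tail_le`. -/
theorem measure_head_le (ν : Measure ℝ) [NullSingletonClass ν] (c : ℝ≥0∞) :
    ν {s | ν (Iio s) ≤ c} ≤ c := by
  have := nullSingletonClass_map_neg ν
  rw [← map_neg_tail]
  exact measure_tail_le _ c

/-- The mirror image of `le_measure_tail`. -/
theorem le_measure_head (ν : Measure ℝ) [NullSingletonClass ν] [IsFiniteMeasure ν] {c : ℝ≥0∞}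
    (hc : 0 < c) {t : ℝ} (ht : c < ν (Iio t)) : c ≤ ν {s | ν (Iio s) ≤ c} := by
  have := nullSingletonClass_map_neg ν
  rw [← map_neg_tail]
  exact le_measure_tail _ hc (t := -t) (by rwa [map_neg_Ioi, neg_neg])

/-- The dyadic level set `{2^j < G ≤ 2^{j+1}}` of `G`. The level sets with `j : ℤ` partition
`{0 < G < ∞}`. -/
def dyadicLevel (G : ℝ → ℝ≥0∞) (j : ℤ) : Set ℝ := {t | 2 ^ j < G t ∧ G t ≤ 2 ^ (j + 1)}

theorem two_zpow_pos (j : ℤ) : (0 : ℝ≥0∞) < 2 ^ j := ENNReal.zpow_pos (by norm_num) (by norm_num) j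

theorem two_zpow_ne_top (j : ℤ) : (2 : ℝ≥0∞) ^ j ≠ ⊤ :=
  (ENNReal.zpow_lt_top (by norm_num) (by norm_num) j).ne

theorem two_zpow_add_one (j : ℤ) : (2 : ℝ≥0∞) ^ (j + 1) = 2 ^ j + 2 ^ j := by
  rw [ENNReal.zpow_add (by norm_num) (by norm_num), zpow_one, mul_two]

theorem measurableSet_dyadicLevel {G : ℝ → ℝ≥0∞} (hG : Measurable G) (j : ℤ) :
    MeasurableSet (dyadicLevel G j) :=
  (measurableSet_lt measurable_const hG).inter (measurableSet_le hG measurable_const)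

theorem pairwise_disjoint_dyadicLevel (G : ℝ → ℝ≥0∞) :
    Pairwise (Function.onFun Disjoint (dyadicLevel G)) := by
  have hm : Monotone fun j : ℤ => (2 : ℝ≥0∞) ^ j :=
    fun i j hij => ENNReal.zpow_le_of_le (by norm_num) hij
  intro i j hij
  exact (hm.pairwise_disjoint_on_Ioc_succ hij).preimage G

theorem lintegral_le_tsum_dyadicLevel (μ : Measure ℝ) {G : ℝ → ℝ≥0∞} (hG : Measurable G)
    (f : ℝ → ℝ≥0∞) (h0 : ∀ t, G t = 0 → f t = 0) (ht : ∀ t, G t ≠ ⊤) :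
    ∫⁻ t, f t ∂μ ≤ ∑' j : ℤ, ∫⁻ t in dyadicLevel G j, f t ∂μ := by
  rw [← lintegral_iUnion (measurableSet_dyadicLevel hG) (pairwise_disjoint_dyadicLevel G),
    ← lintegral_indicator (MeasurableSet.iUnion (measurableSet_dyadicLevel hG))]
  refine lintegral_mono fun t => ?_
  by_cases hz : G t = 0
  · rw [h0 t hz]; exact zero_le
  · obtain ⟨j, hj⟩ := ENNReal.exists_mem_Ioc_zpow hz (ht t) ENNReal.one_lt_two ENNReal.ofNat_ne_top
    rw [indicator_of_mem (mem_iUnion.2 ⟨j, hj⟩)]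

theorem tsum_lintegral_dyadicLevel_le (μ : Measure ℝ) {G : ℝ → ℝ≥0∞} (hG : Measurable G)
    (f : ℝ → ℝ≥0∞) : ∑' j : ℤ, ∫⁻ t in dyadicLevel G j, f t ∂μ ≤ ∫⁻ t, f t ∂μ := by
  rw [← lintegral_iUnion (measurableSet_dyadicLevel hG) (pairwise_disjoint_dyadicLevel G)]
  exact setLIntegral_le_lintegral _ _

/-! ### Duality for weighted Lebesgue spaces -/

/-- The norm of `v^{-1/p}` in `L^{p'}(μ)`, which is the norm of `h ↦ ∫ h dμ` on `L^p(v dμ)`. It is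
written with the exponents of `sigmaP`, so that `σ_p(a, b)` is the case of Lebesgue measure
restricted to `(a, b)`. -/
noncomputable def dualNorm (p : ℝ) (v : ℝ → ℝ≥0∞) (μ : Measure ℝ) : ℝ≥0∞ :=
  if p = 1 then essSup (fun t => (v t)⁻¹) μ
  else (∫⁻ t, v t ^ (1 - p / (p - 1)) ∂μ) ^ (1 / (p / (p - 1)))

theorem dualNorm_mono {p : ℝ} (hp : 1 ≤ p) (v : ℝ → ℝ≥0∞) {μ ν : Measure ℝ} (h : μ ≤ ν) :
    dualNorm p v μ ≤ dualNorm p v ν := by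
  unfold dualNorm
  split_ifs with h1
  · exact essSup_mono_measure h.absolutelyContinuous
  · have : 0 < p - 1 := by rcases hp.lt_or_eq with h | h; linarith; exact absurd h.symm h1
    exact ENNReal.rpow_le_rpow (lintegral_mono' h le_rfl) (by positivity)

/-- Hölder's inequality. Finiteness of both factors on the right is needed, since `0 * ∞ = 0`: if
`v = 0` then the first factor vanishes and the second is infinite. -/
theorem lintegral_le_mul_dualNorm {p : ℝ} (hp : 1 ≤ p) {μ : Measure ℝ} {h v : ℝ → ℝ≥0∞}
    (hh : AEMeasurable h μ) (hv : AEMeasurable v μ) (hN : ∫⁻ t, h t ^ p * v t ∂μ ≠ ⊤)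
    (hσ : dualNorm p v μ ≠ ⊤) :
    ∫⁻ t, h t ∂μ ≤ (∫⁻ t, h t ^ p * v t ∂μ) ^ (1 / p) * dualNorm p v μ := by
  have hfin : ∀ᵐ t ∂μ, h t ^ p * v t < ⊤ := ae_lt_top' ((hh.pow_const p).mul hv) hN
  unfold dualNorm at hσ ⊢
  split_ifs at hσ ⊢ with h1
  · subst h1
    simp only [ENNReal.rpow_one, ne_eq, one_ne_zero, not_false_eq_true, div_self] at hN hfin ⊢
    set D := essSup (fun t => (v t)⁻¹) μ with hD
    rw [← lintegral_mul_const' _ _ hσ]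
    refine lintegral_mono_ae ?_
    filter_upwards [hfin, ENNReal.ae_le_essSup fun t => (v t)⁻¹] with t ht htD
    rcases eq_or_ne (h t) 0 with h0 | h0
    · simp [h0]
    have hvt : v t ≠ ⊤ := by
      rintro hv'
      rw [hv', ENNReal.mul_top h0] at ht
      exact lt_irrefl _ ht
    have hv0 : v t ≠ 0 := by
      rintro hv'
      rw [hv', ENNReal.inv_zero] at htD
      exact hσ (top_le_iff.1 htD)
    calc h t = h t * v t * (v t)⁻¹ := by
          rw [mul_assoc, ENNReal.mul_inv_cancel hv0 hvt, mul_one]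
      _ ≤ _ := by gcongr
  · have hp1 : 0 < p - 1 := by
      rcases hp.lt_or_eq with h | h
      · linarith
      · exact absurd h.symm h1
    have hp0 : 0 < p := by linarith
    set p' := p / (p - 1) with hp'
    have hp'0 : 0 < p' := by positivity
    have hconj : p.HolderConjugate p' := by
      rw [Real.holderConjugate_iff]
      refine ⟨by linarith, by rw [hp']; field_simp; ring⟩
    have hI : ∫⁻ t, v t ^ (1 - p') ∂μ ≠ ⊤ := by
      intro hI
      rw [hI, ENNReal.top_rpow_of_pos (by positivity)] at hσ
      exact hσ rfl
    have hneg : 1 - p' < 0 := by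
      have : 1 - p' = -(1 / (p - 1)) := by rw [hp']; field_simp; ring
      rw [this]; exact neg_neg_of_pos (by positivity)
    have hvfin : ∀ᵐ t ∂μ, v t ^ (1 - p') < ⊤ := ae_lt_top' (hv.pow_const _) hI
    have hH := ENNReal.lintegral_mul_le_Lp_mul_Lq μ hconj
      (f := fun t => h t * v t ^ (1 / p)) (g := fun t => v t ^ (-(1 / p)))
      (hh.mul (hv.pow_const _)) (hv.pow_const _)
    have e1 : -(1 / p) * p' = 1 - p' := by rw [hp']; field_simp; ring
    simp_rw [ENNReal.mul_rpow_of_nonneg _ _ hp0.le, ← ENNReal.rpow_mul, e1,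
      one_div_mul_cancel hp0.ne', ENNReal.rpow_one] at hH
    refine le_trans (lintegral_mono_ae ?_) hH
    filter_upwards [hfin, hvfin] with t ht htv
    rcases eq_or_ne (h t) 0 with h0 | h0
    · simp [h0]
    have hvt : v t ≠ ⊤ := by
      rintro hv'
      rw [hv', ENNReal.mul_top] at ht
      · exact lt_irrefl _ ht
      · simp [h0, hp0.le]
    have hv0 : v t ≠ 0 := by
      rintro hv'
      rw [hv', ENNReal.zero_rpow_of_neg hneg] at htv
      exact lt_irrefl _ htv
    simp only [Pi.mul_apply]
    rw [mul_assoc, ← ENNReal.rpow_add _ _ hv0 hvt]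
    simp

/-- An integral over a σ-finite measure is approximated from below by finite integrals of
measurable minorants; `f` itself need not be measurable. -/
theorem exists_le_lintegral_of_lt {μ : Measure ℝ} [SigmaFinite μ] {f : ℝ → ℝ≥0∞} {L : ℝ≥0∞}
    (hL : L < ∫⁻ x, f x ∂μ) : ∃ g : ℝ → ℝ≥0∞, Measurable g ∧ (∀ x, g x ≤ f x) ∧
      (∀ x, g x ≠ ⊤) ∧ ∫⁻ x, g x ∂μ < ⊤ ∧ L < ∫⁻ x, g x ∂μ := by
  simp_rw [lintegral_eq_nnreal, lt_iSup_iff] at hL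
  obtain ⟨g₀, hg₀, g₀L⟩ := hL
  have h'L : L < ∫⁻ x, g₀ x ∂μ := by
    convert! g₀L
    rw [← SimpleFunc.lintegral_eq_lintegral, SimpleFunc.coe_map]
    simp only [Function.comp_apply]
  obtain ⟨g, hg, gL, gtop⟩ := SimpleFunc.exists_lt_lintegral_simpleFunc_of_lt_lintegral h'L
  exact ⟨fun x => g x, g.measurable.coe_nnreal_ennreal,
    fun x => (ENNReal.coe_le_coe.2 (hg x)).trans (hg₀ x), fun x => ENNReal.coe_ne_top, gL, gtop⟩

/-- Converse of Hölder's inequality: the integral on the unit ball of `L^p(v dμ)` comes arbitrarily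
close to `dualNorm p v μ`, also if the latter is infinite. -/
theorem exists_le_lintegral_of_lt_dualNorm {p : ℝ} (hp : 1 ≤ p) {μ : Measure ℝ} [SigmaFinite μ]
    {v : ℝ → ℝ≥0∞} (hv : AEMeasurable v μ) {l : ℝ≥0∞} (hl : l < dualNorm p v μ ∨ l = 0) :
    ∃ h : ℝ → ℝ≥0∞, Measurable h ∧ ∫⁻ t, h t ^ p * v t ∂μ ≤ 1 ∧ l ≤ ∫⁻ t, h t ∂μ := by
  have hp0 : 0 < p := by linarith
  by_cases hl0 : l = 0
  · exact ⟨fun _ => 0, measurable_const, by simp [hp0], by simp [hl0]⟩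
  replace hl := hl.resolve_right hl0
  unfold dualNorm at hl
  split_ifs at hl with h1
  · subst h1
    -- For `p = 1`, take `h` proportional to a function of finite integral on `{v⁻¹ > l}`.
    have hS : NullMeasurableSet {t | l < (v t)⁻¹} μ := by
      exact nullMeasurableSet_lt aemeasurable_const hv.inv
    have hpos : μ {t | l < (v t)⁻¹} ≠ 0 := by
      intro h0
      refine absurd (essSup_le_of_ae_le l ?_) (not_le.2 hl)
      have : ∀ᵐ t ∂μ, ¬ l < (v t)⁻¹ := by simpa [ae_iff] using h0
      filter_upwards [this] with t ht using not_lt.1 ht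
    obtain ⟨g, hgm, hgf, -, hgt, hg0⟩ := exists_le_lintegral_of_lt
      (μ := μ) (f := {t | l < (v t)⁻¹}.indicator 1) (L := 0)
      (by rw [lintegral_indicator_one₀ hS]; exact hpos.bot_lt)
    set G := ∫⁻ x, g x ∂μ with hG
    refine ⟨fun t => l / G * g t, hgm.const_mul _, ?_, ?_⟩
    · calc ∫⁻ t, (l / G * g t) ^ (1 : ℝ) * v t ∂μ ≤ ∫⁻ t, G⁻¹ * g t ∂μ := by
            refine lintegral_mono fun t => ?_
            simp only [ENNReal.rpow_one]
            by_cases ht : l < (v t)⁻¹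
            · have : l * v t ≤ 1 := by
                calc l * v t ≤ (v t)⁻¹ * v t := by gcongr
                  _ ≤ 1 := ENNReal.inv_mul_le_one _
              calc l / G * g t * v t = G⁻¹ * g t * (l * v t) := by
                    rw [div_eq_mul_inv]; ring
                _ ≤ G⁻¹ * g t * 1 := by gcongr
                _ = _ := mul_one _
            · have h0 : g t = 0 := by
                have := hgf t
                rw [indicator_of_notMem (s := {t | l < (v t)⁻¹}) ht] at this
                exact le_zero_iff.1 this
              simp [h0]
        _ = G⁻¹ * G := by rw [lintegral_const_mul _ hgm]
        _ ≤ 1 := ENNReal.inv_mul_le_one _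
    · rw [lintegral_const_mul _ hgm, ← hG, ENNReal.div_mul_cancel hg0.ne' hgt.ne]
  · have hp1 : 0 < p - 1 := by
      rcases hp.lt_or_eq with h | h
      · linarith
      · exact absurd h.symm h1
    set p' := p / (p - 1) with hp'
    have hp'0 : 0 < p' := by positivity
    have hneg : (1 - p') * (p - 1) = -1 := by rw [hp']; field_simp; ring
    have hneg' : 1 - p' < 0 := by
      have : 1 - p' = -(1 / (p - 1)) := by rw [hp']; field_simp; ring
      rw [this]; exact neg_neg_of_pos (by positivity)
    -- For `p > 1`, take `h` proportional to a minorant `g` of `v^{1-p'}` with finite integral.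
    rw [one_div, ENNReal.lt_rpow_inv_iff hp'0] at hl
    obtain ⟨g, hgm, hgf, hgn, hgt, hgL⟩ := exists_le_lintegral_of_lt hl
    set G := ∫⁻ x, g x ∂μ with hG
    have hG0 : G ≠ 0 := (bot_le.trans_lt hgL).ne'
    have hgp : ∀ t, g t ^ p * v t ≤ g t := by
      intro t
      rcases eq_or_ne (g t) 0 with h0 | h0
      · simp [h0, hp0]
      rcases eq_or_ne (v t) 0 with hv0 | hv0
      · simp [hv0]
      have hvt : v t ≠ ⊤ := by
        intro hvt
        have := hgf t
        rw [hvt, ENNReal.top_rpow_of_neg hneg'] at this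
        exact h0 (le_zero_iff.1 this)
      calc g t ^ p * v t = g t * g t ^ (p - 1) * v t := by
            nth_rw 2 [← ENNReal.rpow_one (g t)]
            rw [← ENNReal.rpow_add _ _ h0 (hgn t)]; congr 2; ring
        _ ≤ g t * (v t ^ (1 - p')) ^ (p - 1) * v t := by gcongr; exact hgf t
        _ = g t := by
            rw [← ENNReal.rpow_mul, hneg, ENNReal.rpow_neg_one, mul_assoc,
              ENNReal.inv_mul_cancel hv0 hvt, mul_one]
    refine ⟨fun t => G ^ (-(1 / p)) * g t, hgm.const_mul _, ?_, ?_⟩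
    · calc ∫⁻ t, (G ^ (-(1 / p)) * g t) ^ p * v t ∂μ ≤ ∫⁻ t, G⁻¹ * g t ∂μ := by
            refine lintegral_mono fun t => ?_
            have e : -(1 / p) * p = -1 := by field_simp
            simp only
            rw [ENNReal.mul_rpow_of_nonneg _ _ hp0.le, ← ENNReal.rpow_mul, e,
              ENNReal.rpow_neg_one, mul_assoc]
            gcongr
            exact hgp t
        _ = G⁻¹ * G := by rw [lintegral_const_mul _ hgm]
        _ ≤ 1 := ENNReal.inv_mul_le_one _
    · rw [lintegral_const_mul _ hgm, ← hG]
      have e : G ^ (-(1 / p)) * G = G ^ (p'⁻¹) := by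
        nth_rw 2 [← ENNReal.rpow_one G]
        rw [← ENNReal.rpow_add _ _ hG0 hgt.ne]
        congr 1
        rw [hp']; field_simp; ring
      rw [e]
      exact ((ENNReal.lt_rpow_inv_iff hp'0).2 hgL).le

theorem exists_le_setLIntegral_of_lt_dualNorm {p : ℝ} (hp : 1 ≤ p) {μ : Measure ℝ} [SigmaFinite μ]
    {v : ℝ → ℝ≥0∞} (hv : AEMeasurable v μ) {s : Set ℝ} (hs : MeasurableSet s) {l : ℝ≥0∞}
    (hl : l < dualNorm p v (μ.restrict s) ∨ l = 0) :
    ∃ h : ℝ → ℝ≥0∞, Measurable h ∧ ∫⁻ t, h t ^ p * v t ∂μ ≤ 1 ∧ l ≤ ∫⁻ t in s, h t ∂μ := by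
  obtain ⟨h, hm, h1, h2⟩ := exists_le_lintegral_of_lt_dualNorm hp hv.restrict hl
  refine ⟨s.indicator h, hm.indicator hs, ?_, ?_⟩
  · rw [← lintegral_indicator hs] at h1
    refine le_trans (lintegral_mono fun t => ?_) h1
    by_cases ht : t ∈ s
    · simp [ht]
    · simp [ht, show 0 < p by linarith]
  · refine h2.trans_eq (setLIntegral_congr_fun hs fun t ht => by simp [ht])

/-! ### Hardy inequalities for measures on the line -/

theorem two_zpow_sub_one_le_of_le_add {j : ℤ} {x : ℝ≥0∞} (h : 2 ^ j ≤ 2 ^ (j - 1) + x) :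
    2 ^ (j - 1) ≤ x := by
  have e : (2 : ℝ≥0∞) ^ j = 2 ^ (j - 1) + 2 ^ (j - 1) := by
    rw [← two_zpow_add_one, sub_add_cancel]
  rw [e] at h
  exact (ENNReal.add_le_add_iff_left (two_zpow_ne_top _)).1 h

/-- If the head `s ↦ ν (Iio s)` exceeds `2^j`, then it sweeps the whole level
`(2^{j-1}, 2^j]`, which therefore carries the mass `2^j - 2^{j-1}`. -/
theorem two_zpow_le_measure_headLevel (ν : Measure ℝ) [NullSingletonClass ν] [IsFiniteMeasure ν]
    {j : ℤ} {t : ℝ} (ht : 2 ^ j < ν (Iio t)) :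
    2 ^ (j - 1) ≤ ν (dyadicLevel (fun s => ν (Iio s)) (j - 1)) := by
  refine two_zpow_sub_one_le_of_le_add ((le_measure_head ν (two_zpow_pos j) ht).trans ?_)
  refine le_trans (measure_mono ?_) ((measure_union_le _ _).trans
    (add_le_add_left (measure_head_le ν (2 ^ (j - 1))) _))
  intro s hs
  by_cases h : ν (Iio s) ≤ 2 ^ (j - 1)
  · exact Or.inl h
  · exact Or.inr ⟨not_le.1 h, by rw [sub_add_cancel]; exact hs⟩

theorem two_zpow_le_measure_tailLevel (ν : Measure ℝ) [NullSingletonClass ν] [IsFiniteMeasure ν]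
    {j : ℤ} {t : ℝ} (ht : 2 ^ j < ν (Ioi t)) :
    2 ^ (j - 1) ≤ ν (dyadicLevel (fun s => ν (Ioi s)) (j - 1)) := by
  refine two_zpow_sub_one_le_of_le_add ((le_measure_tail ν (two_zpow_pos j) ht).trans ?_)
  refine le_trans (measure_mono ?_) ((measure_union_le _ _).trans
    (add_le_add_left (measure_tail_le ν (2 ^ (j - 1))) _))
  intro s hs
  by_cases h : ν (Ioi s) ≤ 2 ^ (j - 1)
  · exact Or.inl h
  · exact Or.inr ⟨not_le.1 h, by rw [sub_add_cancel]; exact hs⟩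

/-- A substitute for `∫ ν(t, ∞)^α dν(t) = ν(ℝ)^{α+1} / (α+1)`: half of the mass lies where the tail
is at least half of the total mass. -/
theorem half_measure_rpow_le (ν : Measure ℝ) [NullSingletonClass ν] {α : ℝ} (hα : 0 ≤ α) :
    (ν univ / 2) ^ (α + 1) ≤ ∫⁻ t, ν (Ioi t) ^ α ∂ν := by
  have hmeas : Measurable fun t => ν (Ioi t) :=
    Antitone.measurable fun a b hab => measure_mono (Ioi_subset_Ioi hab)
  have key : ∀ c : ℝ≥0∞, c ^ α * ν {t | c < ν (Ioi t)} ≤ ∫⁻ t, ν (Ioi t) ^ α ∂ν := by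
    intro c
    rw [← setLIntegral_const]
    refine le_trans (setLIntegral_mono' (measurableSet_lt measurable_const hmeas)
      fun t ht => ?_) (setLIntegral_le_lintegral {t | c < ν (Ioi t)} _)
    exact ENNReal.rpow_le_rpow (le_of_lt ht) hα
  have hsplit : ∀ c : ℝ≥0∞, ν univ ≤ c + ν {t | c < ν (Ioi t)} := by
    intro c
    refine le_trans (measure_mono fun t _ => ?_) ((measure_union_le _ _).trans
      (add_le_add_left (measure_tail_le ν c) _))
    exact le_or_gt (ν (Ioi t)) c
  rcases eq_or_ne (ν univ) ⊤ with ht | ht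
  · have h1 := hsplit 1
    rw [ht, top_le_iff, ENNReal.add_eq_top] at h1
    have h2 := key 1
    rw [h1.resolve_left ENNReal.one_ne_top, ENNReal.one_rpow, one_mul] at h2
    exact le_top.trans h2
  · have hc : ν univ / 2 ≠ ⊤ := ENNReal.div_ne_top ht (by norm_num)
    have h1 := hsplit (ν univ / 2)
    nth_rw 1 [← ENNReal.add_halves (ν univ)] at h1
    rw [ENNReal.add_le_add_iff_left hc] at h1
    refine le_trans ?_ (key (ν univ / 2))
    rw [ENNReal.rpow_add_of_nonneg _ _ hα zero_le_one, ENNReal.rpow_one]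
    gcongr

/-- The bound `ν(t, ∞)^{1/q} σ(t) ≤ A` is inherited by the restriction of `ν` to `E`, whose tails
come up to `ν E` in measure. -/
theorem iInf_mul_measure_rpow_le {ν : Measure ℝ} [NullSingletonClass ν] {q : ℝ} (hq : 0 < q)
    {σ : ℝ → ℝ≥0∞} {A : ℝ≥0∞} (hA : A ≠ ⊤) (h : ∀ᵐ t ∂ν, ν (Ioi t) ^ (1 / q) * σ t ≤ A)
    {E : Set ℝ} (hE : MeasurableSet E) : (⨅ t ∈ E, σ t) * ν E ^ (1 / q) ≤ A := by
  set m := ⨅ t ∈ E, σ t with hm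
  rcases eq_or_ne m 0 with h0 | h0
  · simp [h0]
  have h1 : ∀ᵐ t ∂(ν.restrict E), ν.restrict E (Ioi t) ≤ (A / m) ^ q := by
    filter_upwards [ae_restrict_of_ae h, ae_restrict_mem hE] with t ht htE
    have h2 : ν.restrict E (Ioi t) ^ (1 / q) ≤ A / m := by
      rw [ENNReal.le_div_iff_mul_le (Or.inl h0) (Or.inr hA)]
      refine le_trans ?_ ht
      gcongr
      · exact Measure.restrict_le_self
      · exact iInf₂_le t htE
    rwa [one_div, ENNReal.rpow_inv_le_iff hq] at h2
  have h3 : ν E ≤ (A / m) ^ q := by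
    calc ν E = ν.restrict E univ := by simp
      _ = ν.restrict E {t | ν.restrict E (Ioi t) ≤ (A / m) ^ q} := by
          refine (measure_congr ?_)
          filter_upwards [h1] with t ht
          exact (eq_true ht).symm
      _ ≤ _ := measure_tail_le _ _
  rw [← ENNReal.rpow_inv_le_iff hq, ← one_div] at h3
  calc m * ν E ^ (1 / q) ≤ m * (A / m) := by gcongr
    _ ≤ A := ENNReal.mul_div_le

theorem gapNorm_iInf_le_of_le {ν : Measure ℝ} [NullSingletonClass ν] {p q : ℝ} (hq : 0 < q)
    (hpq : p ≤ q) {σ : ℝ → ℝ≥0∞} {A : ℝ≥0∞} (hA : A ≠ ⊤)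
    (h : ∀ᵐ t ∂ν, ν (Ioi t) ^ (1 / q) * σ t ≤ A)
    {E : ℤ → Set ℝ} (hE : ∀ j, MeasurableSet (E j)) :
    gapNorm p q (fun j => (⨅ t ∈ E j, σ t) * ν (E j) ^ (1 / q)) ≤ A := by
  rw [gapNorm, if_pos hpq]
  exact iSup_le fun j => iInf_mul_measure_rpow_le hq hA h (hE j)

theorem gapNorm_iInf_le_of_lt {ν : Measure ℝ} [NullSingletonClass ν] {p q : ℝ} (hq : 0 < q)
    (hpq : q < p) (σ : ℝ → ℝ≥0∞)
    {E : ℤ → Set ℝ} (hE : ∀ j, MeasurableSet (E j)) (hd : Pairwise (Function.onFun Disjoint E)) :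
    gapNorm p q (fun j => (⨅ t ∈ E j, σ t) * ν (E j) ^ (1 / q)) ≤
      2 ^ (1 / q) * (∫⁻ t, ν (Ioi t) ^ (q / (p - q)) * σ t ^ (p * q / (p - q)) ∂ν) ^
        ((p - q) / (p * q)) := by
  have hp : 0 < p := hq.trans hpq
  have hpq0 : 0 < p - q := by linarith
  rw [gapNorm, if_neg (not_le.2 hpq)]
  set R := p * q / (p - q) with hR
  set α := q / (p - q) with hα
  have hα0 : 0 < α := by positivity
  have hR0 : 0 < R := by positivity
  have e1 : (p - q) / (p * q) = 1 / R := by rw [hR]; field_simp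
  have e2 : 1 / q * R = α + 1 := by rw [hR, hα]; field_simp; ring
  have e3 : (α + 1) * (1 / R) = 1 / q := by rw [← e2]; field_simp
  rw [e1]
  set I := ∫⁻ t, ν (Ioi t) ^ α * σ t ^ R ∂ν with hI
  have key : ∀ j, ((⨅ t ∈ E j, σ t) * ν (E j) ^ (1 / q)) ^ R ≤
      2 ^ (α + 1) * ∫⁻ t in E j, ν (Ioi t) ^ α * σ t ^ R ∂ν := by
    intro j
    set m := ⨅ t ∈ E j, σ t with hm
    have h1 := half_measure_rpow_le (ν.restrict (E j)) hα0.le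
    rw [Measure.restrict_apply_univ] at h1
    have h2 : m ^ R * ∫⁻ t in E j, ν.restrict (E j) (Ioi t) ^ α ∂ν ≤
        ∫⁻ t in E j, ν (Ioi t) ^ α * σ t ^ R ∂ν := by
      rw [← lintegral_const_mul _ (Measurable.pow_const (Antitone.measurable fun a b hab =>
        measure_mono (Ioi_subset_Ioi hab)) _)]
      refine setLIntegral_mono' (hE j) fun t ht => ?_
      rw [mul_comm]
      gcongr
      · exact Measure.restrict_le_self
      · exact iInf₂_le t ht
    calc (m * ν (E j) ^ (1 / q)) ^ R = m ^ R * ν (E j) ^ (α + 1) := by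
          rw [ENNReal.mul_rpow_of_nonneg _ _ hR0.le, ← ENNReal.rpow_mul, e2]
      _ = 2 ^ (α + 1) * (m ^ R * (ν (E j) / 2) ^ (α + 1)) := by
          rw [mul_left_comm, ← ENNReal.mul_rpow_of_nonneg _ _ (by positivity),
            ENNReal.mul_div_cancel (by norm_num) (by norm_num)]
      _ ≤ _ := by
          gcongr
          exact le_trans (by gcongr) h2
  calc _ ≤ (2 ^ (α + 1) * I) ^ (1 / R) := by
        gcongr
        refine (ENNReal.tsum_le_tsum key).trans ?_
        rw [ENNReal.tsum_mul_left, ← lintegral_iUnion hE hd]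
        gcongr
        exact setLIntegral_le_lintegral _ _
    _ = _ := by
        rw [ENNReal.mul_rpow_of_nonneg _ _ (by positivity), ← ENNReal.rpow_mul, e3]

/-- The upper bound in the Hardy inequality for integrable `h`, in terms of the sequences
`(inf_{E_j} σ) ν(E_j)^{1/q}` of disjoint families `E`. -/
theorem lintegral_head_rpow_le_of_integrable {μ ν : Measure ℝ} [NullSingletonClass μ] {p q : ℝ}
    (hp : 1 ≤ p) (hq : 0 < q) {h v : ℝ → ℝ≥0∞} (hh : AEMeasurable h μ) (hv : AEMeasurable v μ)
    (hN : ∫⁻ t, h t ^ p * v t ∂μ ≠ ⊤) (hint : ∫⁻ t, h t ∂μ ≠ ⊤) {B : ℝ≥0∞} (hB : B ≠ ⊤)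
    (hgap : ∀ E : ℤ → Set ℝ, (∀ j, MeasurableSet (E j)) → Pairwise (Function.onFun Disjoint E) →
      gapNorm p q (fun j => (⨅ t ∈ E j, dualNorm p v (μ.restrict (Iio t))) * ν (E j) ^ (1 / q))
        ≤ B) :
    (∫⁻ t, (∫⁻ s in Iio t, h s ∂μ) ^ q ∂ν) ^ (1 / q) ≤
      4 * B * (∫⁻ t, h t ^ p * v t ∂μ) ^ (1 / p) := by
  have hp0 : 0 < p := by linarith
  set H : ℝ → ℝ≥0∞ := fun t => ∫⁻ s in Iio t, h s ∂μ with hH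
  set νh := μ.withDensity h with hνh
  have : IsFiniteMeasure νh := isFiniteMeasure_withDensity hint
  have hHν : H = fun t => νh (Iio t) := by
    ext t; rw [hνh, withDensity_apply _ measurableSet_Iio]
  have hHmono : Monotone H := fun a b hab => lintegral_mono_set (Iio_subset_Iio hab)
  have hHm : Measurable H := hHmono.measurable
  have hHtop : ∀ t, H t ≠ ⊤ := fun t => by rw [hHν]; exact measure_ne_top _ _
  set E : ℤ → Set ℝ := dyadicLevel H with hE
  have hEm : ∀ j, MeasurableSet (E j) := measurableSet_dyadicLevel hHm
  have hEd : Pairwise (Function.onFun Disjoint E) := pairwise_disjoint_dyadicLevel H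
  set σ : ℝ → ℝ≥0∞ := fun t => dualNorm p v (μ.restrict (Iio t)) with hσ
  set s : ℤ → ℝ≥0∞ := fun j => (⨅ t ∈ E j, σ t) * ν (E j) ^ (1 / q) with hs
  have hgs : gapNorm p q s ≤ B := hgap E hEm hEd
  set a : ℤ → ℝ≥0∞ := fun j => (∫⁻ t in E (j - 1), h t ^ p * v t ∂μ) ^ (1 / p) with ha
  have hNj : ∀ j, ∫⁻ t in E j, h t ^ p * v t ∂μ ≠ ⊤ := fun j =>
    ((setLIntegral_le_lintegral _ _).trans_lt hN.lt_top).ne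
  -- The members of the family `E j` that matter are those with `ν (E j) ≠ 0`; on these `σ` is
  -- finite somewhere, since the gap norm is finite, and Hölder's inequality applies on `E (j - 1)`.
  have claim : ∀ j, 2 ^ (j - 1) * ν (E j) ^ (1 / q) ≤ a j * s j := by
    intro j
    rcases eq_or_ne (ν (E j)) 0 with h0 | h0
    · rw [h0, ENNReal.zero_rpow_of_pos (by positivity), mul_zero]; exact zero_le
    set m := ⨅ t ∈ E j, σ t with hm
    have hνpos : ν (E j) ^ (1 / q) ≠ 0 := by
      simp [ENNReal.rpow_eq_zero_iff, h0, hq.le]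
    have hmt : m ≠ ⊤ := by
      intro hmt
      have h1 : s j ≤ B := (le_gapNorm hp0 hq s j).trans hgs
      have h2 : s j = ⊤ := by
        change m * ν (E j) ^ (1 / q) = ⊤
        rw [hmt, ENNReal.top_mul hνpos]
      exact hB (top_le_iff.1 (h2 ▸ h1))
    -- For `t ∈ E j` the level set `E (j - 1)` lies to the left of `t`.
    have hpt : ∀ t ∈ E j, σ t ≠ ⊤ → 2 ^ (j - 1) ≤ a j * σ t := by
      intro t ht hσt
      have h1 : 2 ^ (j - 1) ≤ ∫⁻ x in E (j - 1), h x ∂μ := by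
        have h2 : 2 ^ j < νh (Iio t) := by
          have := ht.1
          rwa [hHν] at this
        have h3 := two_zpow_le_measure_headLevel νh h2
        rwa [← hHν, withDensity_apply _ (measurableSet_dyadicLevel hHm _)] at h3
      have hsub : E (j - 1) ⊆ Iio t := fun x hx => by
        have hx2 : H x ≤ 2 ^ j := by simpa using hx.2
        by_contra! hxt
        exact absurd (ht.1.trans_le (hHmono (not_lt.1 hxt))) (not_lt.2 hx2)
      have hd : dualNorm p v (μ.restrict (E (j - 1))) ≤ σ t :=
        dualNorm_mono hp v (Measure.restrict_mono hsub le_rfl)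
      refine h1.trans ((lintegral_le_mul_dualNorm hp hh.restrict hv.restrict (hNj _)
        (hd.trans_lt hσt.lt_top).ne).trans ?_)
      gcongr
    have haj : a j ≠ ⊤ := ENNReal.rpow_ne_top_of_nonneg (by positivity) (hNj _)
    obtain ⟨t₀, ht₀, hσt₀⟩ : ∃ t ∈ E j, σ t ≠ ⊤ := by
      by_contra! hcon
      exact hmt (by rw [hm]; simpa using hcon)
    have haj0 : a j ≠ 0 := by
      intro h00
      have := hpt t₀ ht₀ hσt₀
      rw [h00, zero_mul] at this
      exact (two_zpow_pos _).ne' (le_zero_iff.1 this)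
    have hmain : 2 ^ (j - 1) ≤ a j * m := by
      rw [mul_comm, ← ENNReal.div_le_iff haj0 haj]
      refine le_iInf₂ fun t ht => ?_
      by_cases hσt : σ t = ⊤
      · rw [hσt]; exact le_top
      · rw [ENNReal.div_le_iff haj0 haj, mul_comm]; exact hpt t ht hσt
    calc 2 ^ (j - 1) * ν (E j) ^ (1 / q) ≤ a j * m * ν (E j) ^ (1 / q) := by gcongr
      _ = a j * s j := mul_assoc _ _ _
  have hlev : ∀ j, ∫⁻ t in E j, H t ^ q ∂ν ≤ 4 ^ q * (a j * s j) ^ q := by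
    intro j
    have e4 : (2 : ℝ≥0∞) ^ (j + 1) = 4 * 2 ^ (j - 1) := by
      rw [two_zpow_add_one]
      have : (2 : ℝ≥0∞) ^ j = 2 ^ (j - 1) + 2 ^ (j - 1) := by
        rw [← two_zpow_add_one, sub_add_cancel]
      rw [this]; ring
    calc ∫⁻ t in E j, H t ^ q ∂ν ≤ ∫⁻ t in E j, (2 ^ (j + 1)) ^ q ∂ν :=
          setLIntegral_mono' (hEm j) fun t ht => ENNReal.rpow_le_rpow ht.2 hq.le
      _ = (4 * (2 ^ (j - 1) * ν (E j) ^ (1 / q))) ^ q := by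
          rw [setLIntegral_const, ← mul_assoc, ← e4, ENNReal.mul_rpow_of_nonneg _ _ hq.le,
            ← ENNReal.rpow_mul (ν (E j)), one_div_mul_cancel hq.ne', ENNReal.rpow_one]
      _ ≤ (4 * (a j * s j)) ^ q := by
          exact ENNReal.rpow_le_rpow (mul_le_mul_right (claim j) 4) hq.le
      _ = _ := ENNReal.mul_rpow_of_nonneg _ _ hq.le
  have hsum : ∑' j, a j ^ p ≤ ∫⁻ t, h t ^ p * v t ∂μ := by
    calc ∑' j, a j ^ p = ∑' j : ℤ, ∫⁻ t in E (j - 1), h t ^ p * v t ∂μ := by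
          congr 1; ext j
          rw [ha, ← ENNReal.rpow_mul, one_div_mul_cancel hp0.ne', ENNReal.rpow_one]
      _ = ∑' j : ℤ, ∫⁻ t in E j, h t ^ p * v t ∂μ :=
          (Equiv.subRight (1 : ℤ)).tsum_eq fun j => ∫⁻ t in E j, h t ^ p * v t ∂μ
      _ ≤ _ := tsum_lintegral_dyadicLevel_le μ hHm _
  calc (∫⁻ t, H t ^ q ∂ν) ^ (1 / q) ≤ (4 ^ q * ∑' j, (a j * s j) ^ q) ^ (1 / q) := by
        gcongr
        rw [← ENNReal.tsum_mul_left]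
        exact (lintegral_le_tsum_dyadicLevel ν hHm _ (fun t ht => by simp [ht, hq]) hHtop).trans
          (ENNReal.tsum_le_tsum hlev)
    _ = 4 * (∑' j, (a j * s j) ^ q) ^ (1 / q) := by
        rw [ENNReal.mul_rpow_of_nonneg _ _ (by positivity), ← ENNReal.rpow_mul,
          mul_one_div_cancel hq.ne', ENNReal.rpow_one]
    _ ≤ 4 * (B * (∫⁻ t, h t ^ p * v t ∂μ) ^ (1 / p)) := by
        gcongr
        refine (tsum_mul_rpow_le_gapNorm hp0 hq a s).trans ?_
        gcongr
    _ = _ := by rw [mul_assoc]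

/-- Reduction to integrable functions: `h` is the increasing limit of the functions `min h n`
restricted to sets of finite measure. -/
theorem lintegral_head_rpow_le_of_truncation {μ ν : Measure ℝ} [SigmaFinite μ] {q : ℝ}
    (hq : 0 < q) {h : ℝ → ℝ≥0∞} (hh : AEMeasurable h μ) {K : ℝ≥0∞}
    (hK : ∀ g : ℝ → ℝ≥0∞, AEMeasurable g μ → (∀ t, g t ≤ h t) → ∫⁻ t, g t ∂μ ≠ ⊤ →
      (∫⁻ t, (∫⁻ s in Iio t, g s ∂μ) ^ q ∂ν) ^ (1 / q) ≤ K) :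
    (∫⁻ t, (∫⁻ s in Iio t, h s ∂μ) ^ q ∂ν) ^ (1 / q) ≤ K := by
  set g : ℕ → ℝ → ℝ≥0∞ := fun n => (spanningSets μ n).indicator fun t => min (h t) n with hg
  have hgm : ∀ n, AEMeasurable (g n) μ := fun n =>
    (hh.min aemeasurable_const).indicator (measurableSet_spanningSets μ n)
  have hgle : ∀ n t, g n t ≤ h t := fun n t =>
    (indicator_le_self' (fun _ _ => zero_le) t).trans (min_le_left _ _)
  have hgi : ∀ n, ∫⁻ t, g n t ∂μ ≠ ⊤ := fun n => by
    refine ne_top_of_le_ne_top (b := n * μ (spanningSets μ n))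
      (ENNReal.mul_ne_top (by simp) (measure_spanningSets_lt_top μ n).ne) ?_
    rw [hg, lintegral_indicator (measurableSet_spanningSets μ n), ← setLIntegral_const]
    exact lintegral_mono fun t => min_le_right _ _
  have hmono : ∀ t, Monotone fun n => g n t := fun t m n hmn => by
    refine (indicator_le_indicator_of_subset (monotone_spanningSets μ hmn)
      (fun _ => zero_le) t).trans ?_
    exact indicator_le_indicator (min_le_min le_rfl (Nat.cast_le.2 hmn))
  have hsup : ∀ t, ⨆ n, g n t = h t := fun t => by
    refine le_antisymm (iSup_le fun n => hgle n t) (le_of_forall_lt fun c hc => ?_)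
    obtain ⟨N, hN⟩ := ENNReal.exists_nat_gt hc.ne_top
    have hmem : t ∈ ⋃ n, spanningSets μ n := by rw [iUnion_spanningSets]; trivial
    obtain ⟨M, hM⟩ := mem_iUnion.1 hmem
    refine lt_of_lt_of_le ?_ (le_iSup _ (max M N))
    rw [hg]
    simp only
    rw [indicator_of_mem (monotone_spanningSets μ (le_max_left M N) hM)]
    refine lt_min hc (hN.trans_le ?_)
    exact_mod_cast le_max_right M N
  have hH : ∀ t, ∫⁻ s in Iio t, h s ∂μ = ⨆ n, ∫⁻ s in Iio t, g n s ∂μ := fun t => by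
    rw [← lintegral_iSup' (fun n => (hgm n).restrict) (Filter.Eventually.of_forall hmono)]
    simp_rw [hsup]
  have hHmono : Monotone fun n t => ∫⁻ s in Iio t, g n s ∂μ := fun m n hmn t =>
    lintegral_mono fun s => hmono s hmn
  have hHq : ∀ t, (∫⁻ s in Iio t, h s ∂μ) ^ q = ⨆ n, (∫⁻ s in Iio t, g n s ∂μ) ^ q := fun t => by
    rw [hH]
    exact (ENNReal.orderIsoRpow q hq).map_iSup _
  have hm : ∀ n, Measurable fun t => (∫⁻ s in Iio t, g n s ∂μ) ^ q := fun n =>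
    (Monotone.measurable fun a b hab => lintegral_mono_set (Iio_subset_Iio hab)).pow_const q
  simp_rw [hHq]
  rw [lintegral_iSup hm fun m n hmn t => ENNReal.rpow_le_rpow (hHmono hmn t) hq.le, one_div,
    ENNReal.rpow_inv_le_iff hq]
  refine iSup_le fun n => ?_
  rw [← ENNReal.rpow_inv_le_iff hq, ← one_div]
  exact hK _ (hgm n) (hgle n) (hgi n)

/-- The upper bound in the Hardy inequality, in terms of the sequences
`(inf_{E_j} σ) ν(E_j)^{1/q}` of disjoint families `E`. -/
theorem lintegral_head_rpow_le {μ ν : Measure ℝ} [NullSingletonClass μ] [SigmaFinite μ] {p q : ℝ}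
    (hp : 1 ≤ p) (hq : 0 < q) {h v : ℝ → ℝ≥0∞} (hh : AEMeasurable h μ) (hv : AEMeasurable v μ)
    (hN : ∫⁻ t, h t ^ p * v t ∂μ ≠ ⊤) {B : ℝ≥0∞} (hB : B ≠ ⊤)
    (hgap : ∀ E : ℤ → Set ℝ, (∀ j, MeasurableSet (E j)) → Pairwise (Function.onFun Disjoint E) →
      gapNorm p q (fun j => (⨅ t ∈ E j, dualNorm p v (μ.restrict (Iio t))) * ν (E j) ^ (1 / q))
        ≤ B) :
    (∫⁻ t, (∫⁻ s in Iio t, h s ∂μ) ^ q ∂ν) ^ (1 / q) ≤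
      4 * B * (∫⁻ t, h t ^ p * v t ∂μ) ^ (1 / p) := by
  refine lintegral_head_rpow_le_of_truncation hq hh fun g hg hgh hgi => ?_
  have hle : ∫⁻ t, g t ^ p * v t ∂μ ≤ ∫⁻ t, h t ^ p * v t ∂μ :=
    lintegral_mono fun t => by
      gcongr
      exact hgh t
  refine (lintegral_head_rpow_le_of_integrable hp hq hg hv (hle.trans_lt hN.lt_top).ne hgi hB
    hgap).trans ?_
  gcongr

/-- Lower bound for the constant in the Hardy inequality, from functions concentrated to the left of
`x` and the values of their primitives to the right of `x`. -/
theorem measure_tail_rpow_mul_dualNorm_le {μ ν : Measure ℝ} [NullSingletonClass ν] [SigmaFinite μ]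
    {p q : ℝ} (hp : 1 ≤ p) (hq : 0 < q) {v : ℝ → ℝ≥0∞} (hv : AEMeasurable v μ) {K : ℝ≥0∞}
    (hK : ∀ h : ℝ → ℝ≥0∞, Measurable h → ∫⁻ t, h t ^ p * v t ∂μ ≤ 1 →
      (∫⁻ t, (∫⁻ s in Iio t, h s ∂μ) ^ q ∂ν) ^ (1 / q) ≤ K) (x : ℝ) :
    ν (Ioi x) ^ (1 / q) * dualNorm p v (μ.restrict (Iio x)) ≤ K := by
  refine ENNReal.mul_le_of_forall_lt fun a ha l hl => ?_
  obtain ⟨h, hm, h1, h2⟩ := exists_le_setLIntegral_of_lt_dualNorm hp hv measurableSet_Iio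
    (Or.inl hl)
  refine le_trans ?_ (hK h hm h1)
  calc a * l ≤ ν (Ioi x) ^ (1 / q) * l := by gcongr
    _ = (∫⁻ t in Ioi x, l ^ q ∂ν) ^ (1 / q) := by
        rw [setLIntegral_const, ENNReal.mul_rpow_of_nonneg _ _ (by positivity), ← ENNReal.rpow_mul,
          mul_one_div_cancel hq.ne', ENNReal.rpow_one, mul_comm]
    _ ≤ _ := by
        refine ENNReal.rpow_le_rpow ?_ (by positivity)
        refine le_trans (setLIntegral_mono' measurableSet_Ioi fun t ht => ?_)
          (setLIntegral_le_lintegral (Ioi x) _)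
        refine ENNReal.rpow_le_rpow (h2.trans ?_) hq.le
        exact lintegral_mono_set (Iio_subset_Iio (le_of_lt ht))

/-- Lower bound for the constant in the Hardy inequality if `q < p`. With `E_j` the dyadic level
sets of the tail, the sequence `s_j = (sup_{E_j} σ) 2^{(j-1)/q}` has `ℓ^{pq/(p-q)}` norm at least a
multiple of the left side. For each `j` a near-extremal function `h_j` for `σ` at a point of
`E_j` has a primitive that is almost `sup_{E_j} σ` on the level set `E_{j-1}`, which lies to the
right of `E_j` and has mass at least `2^{j-1}`. The test function is `(∑ (b_j h_j)^p)^{1/p}`. -/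
theorem lintegral_tail_rpow_mul_dualNorm_le {μ ν : Measure ℝ} [NullSingletonClass ν]
    [IsFiniteMeasure ν] [SigmaFinite μ]
    {p q : ℝ} (hp : 1 ≤ p) (hq : 0 < q) (hpq : q < p) {v : ℝ → ℝ≥0∞} (hv : AEMeasurable v μ)
    {K : ℝ≥0∞} (hK : ∀ h : ℝ → ℝ≥0∞, Measurable h → ∫⁻ t, h t ^ p * v t ∂μ ≤ 1 →
      (∫⁻ t, (∫⁻ s in Iio t, h s ∂μ) ^ q ∂ν) ^ (1 / q) ≤ K) :
    (∫⁻ t, ν (Ioi t) ^ (q / (p - q)) * dualNorm p v (μ.restrict (Iio t)) ^ (p * q / (p - q)) ∂ν) ^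
        ((p - q) / (p * q)) ≤ 4 ^ (1 / q) * (2 * K) := by
  have hp0 : 0 < p := by linarith
  have hpq0 : 0 < p - q := by linarith
  set T : ℝ → ℝ≥0∞ := fun t => ν (Ioi t) with hT
  have hTanti : Antitone T := fun a b hab => measure_mono (Ioi_subset_Ioi hab)
  have hTm : Measurable T := hTanti.measurable
  set σ : ℝ → ℝ≥0∞ := fun t => dualNorm p v (μ.restrict (Iio t)) with hσ
  set E : ℤ → Set ℝ := dyadicLevel T with hE
  have hEm : ∀ j, MeasurableSet (E j) := measurableSet_dyadicLevel hTm
  set S : ℤ → ℝ≥0∞ := fun j => ⨆ t ∈ E j, σ t with hS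
  set d : ℤ → ℝ≥0∞ := fun j => (2 ^ (j - 1)) ^ (1 / q) with hd
  have hd0 : ∀ j, d j ≠ 0 := fun j =>
    (ENNReal.rpow_pos (two_zpow_pos _) (two_zpow_ne_top _)).ne'
  have hdt : ∀ j, d j ≠ ⊤ := fun j => ENNReal.rpow_ne_top_of_nonneg (by positivity)
    (two_zpow_ne_top _)
  have hdq : ∀ j, d j ^ q = 2 ^ (j - 1) := fun j => by
    rw [hd, ← ENNReal.rpow_mul, one_div_mul_cancel hq.ne', ENNReal.rpow_one]
  have hgap : gapNorm p q (fun j => S j * d j) ≤ 2 * K := by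
    refine gapNorm_le_of_forall hp0 hq _ K fun l b hl hb => ?_
    have hex : ∀ j, ∃ h : ℝ → ℝ≥0∞, Measurable h ∧ ∫⁻ t, h t ^ p * v t ∂μ ≤ 1 ∧
        (b j * l j) ^ q ≤ ∫⁻ t in E (j - 1), (b j * ∫⁻ s in Iio t, h s ∂μ) ^ q ∂ν := by
      intro j
      by_cases hl0 : l j = 0
      · exact ⟨fun _ => 0, measurable_const, by simp [hp0], by simp [hl0, hq]⟩
      have hlt : l j / d j < S j :=
        ENNReal.div_lt_of_lt_mul ((hl j).resolve_right hl0)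
      obtain ⟨t₀, ht₀⟩ := lt_iSup_iff.1 hlt
      obtain ⟨ht₀E, hlt₀⟩ := lt_iSup_iff.1 ht₀
      obtain ⟨h, hm, h1, h2⟩ := exists_le_setLIntegral_of_lt_dualNorm hp hv measurableSet_Iio
        (Or.inl hlt₀)
      refine ⟨h, hm, h1, ?_⟩
      have hmass : 2 ^ (j - 1) ≤ ν (E (j - 1)) := two_zpow_le_measure_tailLevel ν ht₀E.1
      calc (b j * l j) ^ q = (b j * (l j / d j)) ^ q * 2 ^ (j - 1) := by
            rw [← hdq j, ← ENNReal.mul_rpow_of_nonneg _ _ hq.le, mul_assoc,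
              ENNReal.div_mul_cancel (hd0 j) (hdt j)]
        _ ≤ (b j * (l j / d j)) ^ q * ν (E (j - 1)) := by gcongr
        _ = ∫⁻ t in E (j - 1), (b j * (l j / d j)) ^ q ∂ν := (setLIntegral_const _ _).symm
        _ ≤ _ := by
            refine setLIntegral_mono' (hEm _) fun t ht => ?_
            have htt : t₀ ≤ t := by
              by_contra! hlt'
              have ht2 : T t ≤ 2 ^ j := by simpa using ht.2
              exact absurd (ht₀E.1.trans_le (hTanti hlt'.le)) (not_lt.2 ht2)
            gcongr
            exact h2.trans (lintegral_mono_set (Iio_subset_Iio htt))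
    choose h hm h1 h2 using hex
    set g : ℝ → ℝ≥0∞ := fun t => (∑' j, (b j * h j t) ^ p) ^ (1 / p) with hg
    have hgm : Measurable g :=
      (Measurable.tsum fun j => ((hm j).const_mul _).pow_const p).pow_const _
    have hgge : ∀ j t, b j * h j t ≤ g t := fun j t => by
      rw [hg, one_div, ENNReal.le_rpow_inv_iff hp0]
      exact ENNReal.le_tsum (f := fun j => (b j * h j t) ^ p) j
    have hgN : ∫⁻ t, g t ^ p * v t ∂μ ≤ 1 := by
      calc ∫⁻ t, g t ^ p * v t ∂μ = ∫⁻ t, ∑' j, b j ^ p * (h j t ^ p * v t) ∂μ := by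
            refine lintegral_congr fun t => ?_
            rw [hg, ← ENNReal.rpow_mul, one_div_mul_cancel hp0.ne', ENNReal.rpow_one,
              ← ENNReal.tsum_mul_right]
            congr 1; ext j
            rw [ENNReal.mul_rpow_of_nonneg _ _ hp0.le, mul_assoc]
        _ = ∑' j, ∫⁻ t, b j ^ p * (h j t ^ p * v t) ∂μ :=
            lintegral_tsum fun j => (((hm j).pow_const p).aemeasurable.mul hv).const_mul _
        _ ≤ ∑' j, b j ^ p := by
            refine ENNReal.tsum_le_tsum fun j => ?_
            have hmj : AEMeasurable (fun t => h j t ^ p * v t) μ :=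
              ((hm j).pow_const p).aemeasurable.mul hv
            rw [lintegral_const_mul'' _ hmj]
            exact mul_le_of_le_one_right' (h1 j)
        _ ≤ 1 := hb
    refine le_trans ?_ (hK g hgm hgN)
    gcongr
    calc ∑' j, (b j * l j) ^ q
        ≤ ∑' j : ℤ, ∫⁻ t in E (j - 1), (∫⁻ s in Iio t, g s ∂μ) ^ q ∂ν := by
          refine ENNReal.tsum_le_tsum fun j => (h2 j).trans (lintegral_mono fun t => ?_)
          refine ENNReal.rpow_le_rpow ?_ hq.le
          rw [← lintegral_const_mul _ (hm j)]
          exact lintegral_mono fun s => hgge j s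
      _ = ∑' j : ℤ, ∫⁻ t in E j, (∫⁻ s in Iio t, g s ∂μ) ^ q ∂ν :=
          (Equiv.subRight (1 : ℤ)).tsum_eq fun j => ∫⁻ t in E j, (∫⁻ s in Iio t, g s ∂μ) ^ q ∂ν
      _ ≤ _ := tsum_lintegral_dyadicLevel_le ν hTm _
  refine le_trans ?_ (mul_le_mul_right hgap _)
  rw [← gapNorm_const_mul hp0 hq, gapNorm, if_neg (not_le.2 hpq)]
  set R := p * q / (p - q) with hR
  set α := q / (p - q) with hα
  have hα0 : 0 < α := by positivity
  have hR0 : 0 < R := by positivity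
  have e2 : 1 / q * R = α + 1 := by rw [hR, hα]; field_simp; ring
  gcongr
  refine (lintegral_le_tsum_dyadicLevel ν hTm _ (fun t ht => ?_) fun t =>
    measure_ne_top _ _).trans (ENNReal.tsum_le_tsum fun j => ?_)
  · change T t ^ α * _ = 0
    rw [ht, ENNReal.zero_rpow_of_pos hα0, zero_mul]
  have e4 : (2 : ℝ≥0∞) ^ (j + 1) = 4 * 2 ^ (j - 1) := by
    rw [two_zpow_add_one]
    have : (2 : ℝ≥0∞) ^ j = 2 ^ (j - 1) + 2 ^ (j - 1) := by
      rw [← two_zpow_add_one, sub_add_cancel]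
    rw [this]; ring
  calc ∫⁻ t in E j, T t ^ α * σ t ^ R ∂ν ≤ ∫⁻ t in E j, (2 ^ (j + 1)) ^ α * S j ^ R ∂ν := by
        refine setLIntegral_mono' (hEm j) fun t ht => ?_
        gcongr
        · exact ht.2
        · exact le_iSup₂ (f := fun t (_ : t ∈ E j) => σ t) t ht
    _ = (2 ^ (j + 1)) ^ α * S j ^ R * ν (E j) := setLIntegral_const _ _
    _ ≤ (2 ^ (j + 1)) ^ α * S j ^ R * 2 ^ (j + 1) := by
        gcongr
        exact (measure_mono fun t ht => ht.2).trans (measure_tail_le ν _)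
    _ = (2 ^ (j + 1)) ^ (α + 1) * S j ^ R := by
        rw [ENNReal.rpow_add_of_nonneg _ _ hα0.le zero_le_one, ENNReal.rpow_one]; ring
    _ = (4 ^ (1 / q) * (S j * d j)) ^ R := by
        rw [← e2, ENNReal.rpow_mul, ← ENNReal.mul_rpow_of_nonneg _ _ hR0.le, e4,
          ENNReal.mul_rpow_of_nonneg 4 _ (by positivity)]
        congr 1
        simp only [hd]; ring

/-! ### Hardy inequalities on an interval -/

/-- The real points of the interval `(a, b)` with extended real end points. -/
def extIoo (a b : EReal) : Set ℝ := {t : ℝ | a < (t : EReal) ∧ (t : EReal) < b}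

theorem measurableSet_extIoo (a b : EReal) : MeasurableSet (extIoo a b) :=
  measurable_coe_real_ereal measurableSet_Ioo

theorem intE_eq (f : ℝ → ℝ≥0∞) (a b : EReal) : intE f a b = ∫⁻ t in extIoo a b, f t := rfl

theorem sigmaP_eq (p : ℝ) (v : ℝ → ℝ≥0∞) (a b : EReal) :
    sigmaP p v a b = dualNorm p v (volume.restrict (extIoo a b)) := rfl

theorem restrict_extIoo_Iio {a b : EReal} {t : ℝ} (ht : (t : EReal) ≤ b) :
    (volume.restrict (extIoo a b)).restrict (Iio t) = volume.restrict (extIoo a t) := by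
  rw [Measure.restrict_restrict measurableSet_Iio]
  congr 1
  ext s
  simp only [extIoo, mem_inter_iff, mem_Iio, mem_ofPred_eq, EReal.coe_lt_coe_iff]
  exact ⟨fun h => ⟨h.2.1, h.1⟩, fun h => ⟨h.2, h.1, (EReal.coe_lt_coe_iff.2 h.2).trans_le ht⟩⟩

theorem restrict_extIoo_Ioi {a b : EReal} {t : ℝ} (ht : a ≤ (t : EReal)) :
    (volume.restrict (extIoo a b)).restrict (Ioi t) = volume.restrict (extIoo t b) := by
  rw [Measure.restrict_restrict measurableSet_Ioi]
  congr 1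
  ext s
  simp only [extIoo, mem_inter_iff, mem_Ioi, mem_ofPred_eq, EReal.coe_lt_coe_iff]
  exact ⟨fun h => ⟨h.1, h.2.2⟩, fun h => ⟨h.1, ht.trans_lt (EReal.coe_lt_coe_iff.2 h.1), h.2⟩⟩

/-- Including the left end point of the interval does not change Lebesgue measure on it. -/
theorem restrict_extIco_eq (a b : EReal) :
    volume.restrict {y : ℝ | a ≤ (y : EReal) ∧ (y : EReal) < b} =
      volume.restrict (extIoo a b) := by
  refine Measure.restrict_congr_set (ae_eq_set.2 ⟨?_, ?_⟩)
  · refine Set.Subsingleton.measure_zero (fun s hs t ht => ?_) _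
    have h : ∀ y : ℝ, y ∈ {y : ℝ | a ≤ (y : EReal) ∧ (y : EReal) < b} \ extIoo a b →
        (y : EReal) = a := fun y hy => by
      by_contra hne
      exact hy.2 ⟨lt_of_le_of_ne hy.1.1 (Ne.symm hne), hy.1.2⟩
    exact EReal.coe_injective ((h s hs).trans (h t ht).symm)
  · have hsub : extIoo a b ⊆ {y : ℝ | a ≤ (y : EReal) ∧ (y : EReal) < b} :=
      fun y hy => ⟨hy.1.le, hy.2⟩
    rw [sdiff_eq_empty.2 hsub, measure_empty]

theorem IsMPos.aemeasurable_extIoo {f : ℝ → ℝ≥0∞} (hf : IsMPos f) {a : EReal} (ha : 0 ≤ a)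
    (b : EReal) : AEMeasurable f (volume.restrict (extIoo a b)) :=
  AEMeasurable.mono_set (fun t ht => by
    have : (0 : EReal) < (t : EReal) := ha.trans_lt ht.1
    exact EReal.coe_pos.1 this) hf

/-- The norm of `t ↦ ∫_a^t h` in `L^q(w)` on `(a, b)`. -/
noncomputable def hardyNorm (q : ℝ) (w : ℝ → ℝ≥0∞) (a b : EReal) (h : ℝ → ℝ≥0∞) : ℝ≥0∞ :=
  (intE (fun t => (intE h a t) ^ q * w t) a b) ^ (1 / q)

/-- The quantity on `(a, b)` that is equivalent to the best constant in the Hardy inequality there: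
the member of the sequence in `A₁` or `A₂` without its power of `2`. -/
noncomputable def hardyConst (p q : ℝ) (v w : ℝ → ℝ≥0∞) (a b : EReal) : ℝ≥0∞ :=
  if p ≤ q then
    essSup (fun y : ℝ => (intE w y b) ^ (1 / q) * sigmaP p v a y)
      (volume.restrict {y : ℝ | a ≤ (y : EReal) ∧ (y : EReal) < b})
  else
    (intE (fun y : ℝ => (intE w y b) ^ (q / (p - q)) * w y *
      (sigmaP p v a y) ^ (p * q / (p - q))) a b) ^ ((p - q) / (p * q))

section Interval

variable {p q : ℝ} {v w : ℝ → ℝ≥0∞} {a b : EReal}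

theorem withDensity_Ioi (w : ℝ → ℝ≥0∞) {t : ℝ} (ht : a ≤ (t : EReal)) :
    (volume.restrict (extIoo a b)).withDensity w (Ioi t) = intE w t b := by
  rw [withDensity_apply _ measurableSet_Ioi, restrict_extIoo_Ioi ht, intE_eq]

theorem hardyNorm_eq (hw : AEMeasurable w (volume.restrict (extIoo a b))) (h : ℝ → ℝ≥0∞) :
    hardyNorm q w a b h =
      (∫⁻ t, (∫⁻ s in Iio t, h s ∂(volume.restrict (extIoo a b))) ^ q
        ∂((volume.restrict (extIoo a b)).withDensity w)) ^ (1 / q) := by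
  have hm : Measurable fun t => (∫⁻ s in Iio t, h s ∂(volume.restrict (extIoo a b))) ^ q :=
    (Monotone.measurable fun a b hab => lintegral_mono_set (Iio_subset_Iio hab)).pow_const q
  rw [lintegral_withDensity_eq_lintegral_mul₀ hw hm.aemeasurable, hardyNorm, intE_eq]
  congr 1
  refine setLIntegral_congr_fun (measurableSet_extIoo a b) fun t ht => ?_
  simp only [Pi.mul_apply]
  rw [restrict_extIoo_Iio ht.2.le, intE_eq, mul_comm]

theorem essSup_tail_mul_dualNorm_eq :
    essSup (fun y : ℝ => (intE w y b) ^ (1 / q) * sigmaP p v a y)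
      (volume.restrict {y : ℝ | a ≤ (y : EReal) ∧ (y : EReal) < b}) =
    essSup (fun t => (volume.restrict (extIoo a b)).withDensity w (Ioi t) ^ (1 / q) *
      dualNorm p v ((volume.restrict (extIoo a b)).restrict (Iio t)))
      (volume.restrict (extIoo a b)) := by
  rw [restrict_extIco_eq]
  refine essSup_congr_ae ?_
  filter_upwards [ae_restrict_mem (measurableSet_extIoo a b)] with t ht
  rw [withDensity_Ioi w ht.1.le, restrict_extIoo_Iio ht.2.le, sigmaP_eq]

theorem intE_tail_mul_dualNorm_eq (hp : 1 ≤ p)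
    (hw : AEMeasurable w (volume.restrict (extIoo a b))) :
    intE (fun y : ℝ => (intE w y b) ^ (q / (p - q)) * w y *
      (sigmaP p v a y) ^ (p * q / (p - q))) a b =
    ∫⁻ t, (volume.restrict (extIoo a b)).withDensity w (Ioi t) ^ (q / (p - q)) *
      dualNorm p v ((volume.restrict (extIoo a b)).restrict (Iio t)) ^ (p * q / (p - q))
      ∂((volume.restrict (extIoo a b)).withDensity w) := by
  have hm1 : Measurable fun t => (volume.restrict (extIoo a b)).withDensity w (Ioi t) :=
    Antitone.measurable fun s t hst => measure_mono (Ioi_subset_Ioi hst)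
  have hm2 : Measurable fun t => dualNorm p v ((volume.restrict (extIoo a b)).restrict (Iio t)) :=
    Monotone.measurable fun s t hst =>
      dualNorm_mono hp v (Measure.restrict_mono (Iio_subset_Iio hst) le_rfl)
  have hm : Measurable fun t =>
      (volume.restrict (extIoo a b)).withDensity w (Ioi t) ^ (q / (p - q)) *
        dualNorm p v ((volume.restrict (extIoo a b)).restrict (Iio t)) ^ (p * q / (p - q)) :=
    (hm1.pow_const _).mul (hm2.pow_const _)
  rw [lintegral_withDensity_eq_lintegral_mul₀ hw hm.aemeasurable, intE_eq]
  refine setLIntegral_congr_fun (measurableSet_extIoo a b) fun t ht => ?_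
  simp only [Pi.mul_apply]
  rw [withDensity_Ioi w ht.1.le, restrict_extIoo_Iio ht.2.le, sigmaP_eq]
  ring

/-- The Hardy inequality on `(a, b)`. Both factors on the right have to be finite, since
`0 * ∞ = 0`. -/
theorem hardyNorm_le (hp : 1 ≤ p) (hq : 0 < q)
    (hv : AEMeasurable v (volume.restrict (extIoo a b)))
    (hw : AEMeasurable w (volume.restrict (extIoo a b))) {h : ℝ → ℝ≥0∞}
    (hh : AEMeasurable h (volume.restrict (extIoo a b)))
    (hN : intE (fun t => h t ^ p * v t) a b ≠ ⊤) (hA : hardyConst p q v w a b ≠ ⊤) :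
    hardyNorm q w a b h ≤ 4 * (2 ^ (1 / q) * hardyConst p q v w a b) *
      (intE (fun t => h t ^ p * v t) a b) ^ (1 / p) := by
  rw [hardyNorm_eq hw]
  refine lintegral_head_rpow_le hp hq hh hv hN (ENNReal.mul_ne_top
    (ENNReal.rpow_ne_top_of_nonneg (by positivity) (by norm_num)) hA) fun E hE hd => ?_
  by_cases hpq : p ≤ q
  · rw [hardyConst, if_pos hpq, essSup_tail_mul_dualNorm_eq] at hA ⊢
    refine (gapNorm_iInf_le_of_le hq hpq hA ?_ hE).trans ?_
    · exact (withDensity_absolutelyContinuous _ w).ae_le (ENNReal.ae_le_essSup _)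
    · refine le_mul_of_one_le_left' ?_
      exact ENNReal.one_le_rpow (by norm_num) (by positivity)
  · rw [hardyConst, if_neg hpq, intE_tail_mul_dualNorm_eq hp hw]
    exact gapNorm_iInf_le_of_lt hq (not_le.1 hpq) _ hE hd

theorem ae_eq_top_of_dualNorm_eq_zero (hp : 1 ≤ p) {μ : Measure ℝ} (hv : AEMeasurable v μ)
    (h : dualNorm p v μ = 0) : ∀ᵐ t ∂μ, v t = ⊤ := by
  unfold dualNorm at h
  split_ifs at h with h1
  · filter_upwards [ENNReal.ae_le_essSup (μ := μ) fun t => (v t)⁻¹] with t ht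
    rw [h] at ht
    exact ENNReal.inv_eq_zero.1 (le_zero_iff.1 ht)
  · have hp1 : 0 < p - 1 := by
      rcases hp.lt_or_eq with h | h
      · linarith
      · exact absurd h.symm h1
    have hp0 : 0 < 1 / (p / (p - 1)) := by positivity
    have h2 : ∫⁻ t, v t ^ (1 - p / (p - 1)) ∂μ = 0 := by
      rcases ENNReal.rpow_eq_zero_iff.1 h with h | h
      · exact h.1
      · exact absurd h.2 (not_lt.2 hp0.le)
    rw [lintegral_eq_zero_iff' (hv.pow_const _)] at h2
    filter_upwards [h2] with t ht
    have hneg : 1 - p / (p - 1) < 0 := by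
      have : 1 - p / (p - 1) = -(1 / (p - 1)) := by field_simp; ring
      rw [this]; exact neg_neg_of_pos (by positivity)
    rcases ENNReal.rpow_eq_zero_iff.1 ht with h | h
    · exact absurd h.2 (not_lt.2 hneg.le)
    · exact h.1

theorem extIoo_mono {a a' b b' : EReal} (ha : a' ≤ a) (hb : b ≤ b') :
    extIoo a b ⊆ extIoo a' b' := fun _ ht => ⟨ha.trans_lt ht.1, ht.2.trans_le hb⟩

theorem volume_extIoo_pos {a b : EReal} (h : a < b) : 0 < volume (extIoo a b) := by
  obtain ⟨c, hac, hcb⟩ := EReal.lt_iff_exists_real_btwn.1 h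
  obtain ⟨d, hcd, hdb⟩ := EReal.lt_iff_exists_real_btwn.1 hcb
  refine lt_of_lt_of_le ?_ (measure_mono (s := Ioo c d) fun t ht => ?_)
  · rw [Real.volume_Ioo]; simpa using hcd
  · exact ⟨hac.trans (EReal.coe_lt_coe_iff.2 ht.1), (EReal.coe_lt_coe_iff.2 ht.2).trans hdb⟩

theorem sigmaP_ne_zero (hp : 1 ≤ p) (hv : IsWeight v) (ha : 0 ≤ a) {y : ℝ}
    (hy : a < (y : EReal)) : sigmaP p v a y ≠ 0 := by
  intro h
  rw [sigmaP_eq] at h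
  have h1 := ae_eq_top_of_dualNorm_eq_zero hp (hv.1.aemeasurable_extIoo ha y) h
  have hy0 : 0 < y := EReal.coe_pos.1 (ha.trans_lt hy)
  have h2 := (hv.2 y hy0).2
  refine h2.ne (top_le_iff.1 ?_)
  calc ⊤ = ⊤ * volume (extIoo a y) := (ENNReal.top_mul (volume_extIoo_pos hy).ne').symm
    _ = ∫⁻ t in extIoo a y, ⊤ := (setLIntegral_const _ _).symm
    _ = ∫⁻ t in extIoo a y, v t := lintegral_congr_ae (h1.mono fun t ht => ht.symm)
    _ ≤ intE v 0 y := lintegral_mono_set (extIoo_mono ha le_rfl)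

/-- Finiteness of the Hardy constant forces `w` to be integrable on `(a, b)`: near `b` because `σ`
does not vanish, and near `a` because `w` is a weight. -/
theorem withDensity_extIoo_ne_top (hp : 1 ≤ p) (hq : 0 < q) (hv : IsWeight v) (hw : IsWeight w)
    (ha : 0 ≤ a) {K : ℝ≥0∞} (hK : K ≠ ⊤)
    (h : ∀ y : ℝ, (volume.restrict (extIoo a b)).withDensity w (Ioi y) ^ (1 / q) *
      dualNorm p v ((volume.restrict (extIoo a b)).restrict (Iio y)) ≤ K) :
    (volume.restrict (extIoo a b)).withDensity w univ ≠ ⊤ := by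
  set ν := (volume.restrict (extIoo a b)).withDensity w with hν
  rcases (extIoo a b).eq_empty_or_nonempty with h0 | ⟨y, hy⟩
  · rw [hν, h0]; simp
  have hy0 : 0 < y := EReal.coe_pos.1 (ha.trans_lt hy.1)
  have h1 : ν (Ioi y) ≠ ⊤ := by
    intro ht
    have h2 := h y
    rw [ht, ENNReal.top_rpow_of_pos (by positivity), restrict_extIoo_Iio hy.2.le, ← sigmaP_eq,
      ENNReal.top_mul (sigmaP_ne_zero hp hv ha hy.1)] at h2
    exact hK (top_le_iff.1 h2)
  have h2 : ν (Iic y) ≠ ⊤ := by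
    refine ne_top_of_le_ne_top (hw.2 (y + 1) (by linarith)).2.ne ?_
    rw [hν, withDensity_apply _ measurableSet_Iic, Measure.restrict_restrict measurableSet_Iic]
    refine lintegral_mono_set fun t ht => ?_
    refine ⟨ha.trans_lt ht.2.1, EReal.coe_lt_coe_iff.2 ?_⟩
    have : t ≤ y := ht.1
    linarith
  rw [← Iic_union_Ioi (a := y)]
  exact ((measure_union_le _ _).trans_lt (ENNReal.add_lt_top.2 ⟨h2.lt_top, h1.lt_top⟩)).ne

/-- Every constant in the Hardy inequality on `(a, b)` dominates `hardyConst`, up to a factor. -/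
theorem hardyConst_le (hp : 1 ≤ p) (hq : 0 < q) (hv : IsWeight v) (hw : IsWeight w) (ha : 0 ≤ a)
    {K : ℝ≥0∞} (hK : ∀ h : ℝ → ℝ≥0∞, Measurable h → intE (fun t => h t ^ p * v t) a b ≤ 1 →
      hardyNorm q w a b h ≤ K) :
    hardyConst p q v w a b ≤ 4 ^ (1 / q) * 2 * K := by
  have hvm := hv.1.aemeasurable_extIoo ha b
  have hwm := hw.1.aemeasurable_extIoo ha b
  simp_rw [hardyNorm_eq hwm] at hK
  have htail := measure_tail_rpow_mul_dualNorm_le hp hq hvm hK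
  by_cases hpq : p ≤ q
  · rw [hardyConst, if_pos hpq, essSup_tail_mul_dualNorm_eq]
    refine (essSup_le_of_ae_le K (Filter.Eventually.of_forall htail)).trans ?_
    refine le_mul_of_one_le_left' (one_le_mul ?_ (by norm_num))
    exact ENNReal.one_le_rpow (by norm_num) (by positivity)
  · rw [hardyConst, if_neg hpq, intE_tail_mul_dualNorm_eq hp hwm]
    rcases eq_or_ne K ⊤ with rfl | hKt
    · rw [ENNReal.mul_top]
      · exact le_top
      · exact mul_ne_zero (ENNReal.rpow_pos (by norm_num) (by norm_num)).ne' (by norm_num)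
    have : IsFiniteMeasure ((volume.restrict (extIoo a b)).withDensity w) :=
      ⟨(withDensity_extIoo_ne_top hp hq hv hw ha hKt htail).lt_top⟩
    rw [mul_assoc]
    exact lintegral_tail_rpow_mul_dualNorm_le hp hq (not_le.1 hpq) hvm hK

end Interval

/-! ### The discrete inequality -/

theorem IsCoveringSequence.pos {u : ℝ → ℝ≥0∞} {Z : Set ℤ} {x : ℤ → EReal}
    (hx : IsCoveringSequence u Z x) {k : ℤ} (hk : k ∈ Z) : 0 < x k := by
  rcases hx with ⟨-, -, -, h⟩ | ⟨M, -, -, rfl, -, -, h⟩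
  · exact (h k).1
  · exact (h k hk).1

theorem IsCoveringSequence.le {u : ℝ → ℝ≥0∞} {Z : Set ℤ} {x : ℤ → EReal}
    (hx : IsCoveringSequence u Z x) {k l : ℤ} (hl : l ∈ Z) (hkl : k < l) :
    x (k + 1) ≤ x l := by
  rcases hx with ⟨-, -, h, -⟩ | ⟨M, -, -, rfl, -, h, -⟩
  · exact h.monotone hkl
  · exact h.monotoneOn (le_trans (Int.add_one_le_of_lt hkl) hl) hl hkl

theorem IsCoveringSequence.disjoint {u : ℝ → ℝ≥0∞} {Z : Set ℤ} {x : ℤ → EReal}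
    (hx : IsCoveringSequence u Z x) {k l : Z} {t : ℝ} (hk : t ∈ extIoo (x k) (x (k + 1)))
    (hl : t ∈ extIoo (x l) (x (l + 1))) : k = l := by
  rcases lt_trichotomy (k : ℤ) l with h | h | h
  · exact absurd (hk.2.trans_le ((hx.le l.2 h).trans hl.1.le)) (lt_irrefl _)
  · exact Subtype.ext h
  · exact absurd (hl.2.trans_le ((hx.le k.2 h).trans hk.1.le)) (lt_irrefl _)

theorem two_rpow_ne_zero (y : ℝ) : (2 : ℝ≥0∞) ^ y ≠ 0 :=
  (ENNReal.rpow_pos (by norm_num) (by norm_num)).ne'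

theorem two_rpow_ne_top (y : ℝ) : (2 : ℝ≥0∞) ^ y ≠ ⊤ :=
  ENNReal.rpow_ne_top_of_ne_zero (by norm_num) (by norm_num)

section Covering

variable {p q r : ℝ} {u v w : ℝ → ℝ≥0∞} {Z : Set ℤ} {x : ℤ → EReal}

/-- The discrete inequality in terms of `hardyNorm`; the `ℓ^p` norm on the right is the sum of the
integrals, as `(·)^{1/p}` and `(·)^p` cancel. -/
theorem discreteIneq_iff (hp : 0 < p) (hr : 0 < r) {C : ℝ≥0∞} :
    DiscreteIneq p q r v w Z x C ↔ ∀ h : ℝ → ℝ≥0∞, IsMPos h →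
      (∑' k : Z, (2 ^ ((k : ℝ) / r) * hardyNorm q w (x k) (x (k + 1)) h) ^ r) ^ (1 / r) ≤
        C * (∑' k : Z, intE (fun t => h t ^ p * v t) (x k) (x (k + 1))) ^ (1 / p) := by
  unfold DiscreteIneq
  simp_rw [ellNorm_ofReal hr, ellNorm_ofReal hp, ← ENNReal.rpow_mul, one_div_mul_cancel hp.ne',
    ENNReal.rpow_one]
  rfl

theorem bestConst_le (hp : 1 ≤ p) (hq : 0 < q) (hr : 0 < r) (hv : IsWeight v) (hw : IsWeight w)
    (hx : IsCoveringSequence u Z x) :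
    bestConst p q r v w Z x ≤ 4 * 2 ^ (1 / q) *
      gapNorm p r (fun k : Z => 2 ^ ((k : ℝ) / r) * hardyConst p q v w (x k) (x (k + 1))) := by
  have hp0 : 0 < p := by linarith
  set s : Z → ℝ≥0∞ := fun k => 2 ^ ((k : ℝ) / r) * hardyConst p q v w (x k) (x (k + 1)) with hs
  set c : ℝ≥0∞ := 4 * 2 ^ (1 / q) with hc
  have hc0 : c ≠ 0 := mul_ne_zero (by norm_num) (two_rpow_ne_zero _)
  -- A constant `C > 0` makes the inequality trivial for an infinite right side, in spite of
  -- `0 * ∞ = 0`.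
  refine le_of_forall_gt_imp_ge_of_dense fun C hC => sInf_le ?_
  have hC0 : C ≠ 0 := (bot_le.trans_lt hC).ne'
  refine (discreteIneq_iff hp0 hr).2 fun h hh => ?_
  set N : Z → ℝ≥0∞ := fun k => intE (fun t => h t ^ p * v t) (x k) (x (k + 1)) with hN
  rcases eq_or_ne (∑' k, N k) ⊤ with ht | ht
  · rw [ht, ENNReal.top_rpow_of_pos (by positivity), ENNReal.mul_top hC0]
    exact le_top
  have hst : gapNorm p r s ≠ ⊤ := by
    intro h
    rw [h, ENNReal.mul_top hc0] at hC
    exact not_top_lt hC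
  -- The Hardy inequality on each interval.
  have hterm : ∀ k : Z, 2 ^ ((k : ℝ) / r) * hardyNorm q w (x k) (x (k + 1)) h ≤
      N k ^ (1 / p) * (c * s k) := by
    intro k
    have hA : hardyConst p q v w (x k) (x (k + 1)) ≠ ⊤ := by
      intro hA
      have h1 := le_gapNorm hp0 hr s k
      rw [hs] at h1
      simp only at h1
      rw [hA, ENNReal.mul_top (two_rpow_ne_zero _)] at h1
      exact hst (top_le_iff.1 h1)
    have hk := (hx.pos k.2).le
    have h2 := hardyNorm_le hp hq (hv.1.aemeasurable_extIoo hk (x (k + 1)))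
      (hw.1.aemeasurable_extIoo hk (x (k + 1))) (hh.aemeasurable_extIoo hk (x (k + 1)))
      (ENNReal.ne_top_of_tsum_ne_top ht k) hA
    calc _ ≤ 2 ^ ((k : ℝ) / r) * _ := mul_le_mul_right h2 _
      _ = _ := by rw [hs, hc]; ring
  calc _ ≤ (∑' k, (N k ^ (1 / p) * (c * s k)) ^ r) ^ (1 / r) := by
        refine ENNReal.rpow_le_rpow (ENNReal.tsum_le_tsum fun k => ?_) (by positivity)
        exact ENNReal.rpow_le_rpow (hterm k) hr.le
    _ ≤ gapNorm p r (fun k => c * s k) * (∑' k, (N k ^ (1 / p)) ^ p) ^ (1 / p) :=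
        tsum_mul_rpow_le_gapNorm hp0 hr _ _
    _ ≤ C * (∑' k, N k) ^ (1 / p) := by
        simp_rw [← ENNReal.rpow_mul, one_div_mul_cancel hp0.ne', ENNReal.rpow_one]
        rw [gapNorm_const_mul hp0 hr]
        exact mul_le_mul_left hC.le _

theorem gapNorm_le_bestConst (hp : 1 ≤ p) (hq : 0 < q) (hr : 0 < r) (hv : IsWeight v)
    (hw : IsWeight w) (hx : IsCoveringSequence u Z x) :
    (4 ^ (1 / q) * 2 * 2)⁻¹ *
      gapNorm p r (fun k : Z => 2 ^ ((k : ℝ) / r) * hardyConst p q v w (x k) (x (k + 1))) ≤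
      bestConst p q r v w Z x := by
  have hp0 : 0 < p := by linarith
  set D : ℝ≥0∞ := 4 ^ (1 / q) * 2 with hD
  have hD0 : D ≠ 0 := mul_ne_zero (ENNReal.rpow_pos (by norm_num) (by norm_num)).ne' (by norm_num)
  have hDt : D ≠ ⊤ := ENNReal.mul_ne_top
    (ENNReal.rpow_ne_top_of_ne_zero (by norm_num) (by norm_num)) (by norm_num)
  refine le_sInf fun C hC => ?_
  have hC := (discreteIneq_iff hp0 hr).1 hC
  set s : Z → ℝ≥0∞ := fun k => 2 ^ ((k : ℝ) / r) * hardyConst p q v w (x k) (x (k + 1)) with hs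
  have key : gapNorm p r (fun k => D⁻¹ * s k) ≤ 2 * C := by
    refine gapNorm_le_of_forall hp0 hr _ C fun l b hl hb => ?_
    have hex : ∀ k : Z, ∃ h : ℝ → ℝ≥0∞, Measurable h ∧
        intE (fun t => h t ^ p * v t) (x k) (x (k + 1)) ≤ 1 ∧
        l k ≤ 2 ^ ((k : ℝ) / r) * hardyNorm q w (x k) (x (k + 1)) h := by
      intro k
      by_cases hl0 : l k = 0
      · exact ⟨fun _ => 0, measurable_const, by simp [intE, hp0], by rw [hl0]; exact zero_le⟩
      by_contra! hcon
      have h1 := hardyConst_le (b := x (k + 1)) (K := l k / 2 ^ ((k : ℝ) / r)) hp hq hv hw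
        (hx.pos k.2).le fun h hm hN => by
          rw [ENNReal.le_div_iff_mul_le (Or.inl (two_rpow_ne_zero _))
            (Or.inl (two_rpow_ne_top _)), mul_comm]
          exact (hcon h hm hN).le
      refine absurd ((hl k).resolve_right hl0) (not_lt.2 ?_)
      calc D⁻¹ * s k ≤ D⁻¹ * (2 ^ ((k : ℝ) / r) * (D * (l k / 2 ^ ((k : ℝ) / r)))) := by
            gcongr
            exact mul_le_mul_right h1 _
        _ = (D⁻¹ * D) * (2 ^ ((k : ℝ) / r) * (l k / 2 ^ ((k : ℝ) / r))) := by ring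
        _ = l k := by
            rw [ENNReal.inv_mul_cancel hD0 hDt, one_mul,
              ENNReal.mul_div_cancel (two_rpow_ne_zero _) (two_rpow_ne_top _)]
    choose h hm h1 h2 using hex
    -- Near-extremal functions on the intervals, superposed with coefficients `b k`.
    set g : ℝ → ℝ≥0∞ := fun t =>
      ∑' k : Z, (extIoo (x k) (x (k + 1))).indicator (fun t => b k * h k t) t with hg
    have hgm : Measurable g := Measurable.tsum fun k =>
      ((hm k).const_mul _).indicator (measurableSet_extIoo _ _)
    have hgk : ∀ k : Z, ∀ t ∈ extIoo (x k) (x (k + 1)), g t = b k * h k t := by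
      intro k t ht
      rw [hg]
      simp only
      rw [tsum_eq_single k, indicator_of_mem ht]
      intro j hj
      exact indicator_of_notMem (fun htj => hj (hx.disjoint htj ht)) _
    have hN : ∀ k : Z, intE (fun t => g t ^ p * v t) (x k) (x (k + 1)) ≤ b k ^ p := by
      intro k
      have hmk : AEMeasurable (fun t => h k t ^ p * v t)
          (volume.restrict (extIoo (x k) (x (k + 1)))) :=
        ((hm k).pow_const p).aemeasurable.mul (hv.1.aemeasurable_extIoo (hx.pos k.2).le _)
      calc intE (fun t => g t ^ p * v t) (x k) (x (k + 1))
          = ∫⁻ t in extIoo (x k) (x (k + 1)), b k ^ p * (h k t ^ p * v t) :=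
            setLIntegral_congr_fun (measurableSet_extIoo _ _) fun t ht => by
              rw [hgk k t ht, ENNReal.mul_rpow_of_nonneg _ _ hp0.le, mul_assoc]
        _ = b k ^ p * intE (fun t => h k t ^ p * v t) (x k) (x (k + 1)) :=
            lintegral_const_mul'' _ hmk
        _ ≤ b k ^ p := mul_le_of_le_one_right' (h1 k)
    have hH : ∀ k : Z, b k * hardyNorm q w (x k) (x (k + 1)) (h k) ≤
        hardyNorm q w (x k) (x (k + 1)) g := by
      intro k
      have hwm := hw.1.aemeasurable_extIoo (hx.pos k.2).le (x (k + 1))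
      have hHm : AEMeasurable (fun t : ℝ => (intE (h k) (x k) t) ^ q * w t)
          (volume.restrict (extIoo (x k) (x (k + 1)))) := by
        refine AEMeasurable.mul (Measurable.aemeasurable (Measurable.pow_const
          (Monotone.measurable fun s t hst => ?_) _)) hwm
        exact lintegral_mono_set (extIoo_mono le_rfl (EReal.coe_le_coe_iff.2 hst))
      have e : b k = (b k ^ q) ^ (1 / q) := by
        rw [← ENNReal.rpow_mul, mul_one_div_cancel hq.ne', ENNReal.rpow_one]
      rw [hardyNorm, hardyNorm, e, ← ENNReal.mul_rpow_of_nonneg _ _ (by positivity), intE_eq,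
        ← lintegral_const_mul'' _ hHm]
      refine ENNReal.rpow_le_rpow (setLIntegral_mono' (measurableSet_extIoo _ _) fun t ht => ?_)
        (by positivity)
      rw [← mul_assoc, ← ENNReal.mul_rpow_of_nonneg _ _ hq.le]
      gcongr
      rw [intE_eq, intE_eq, ← lintegral_const_mul _ (hm k)]
      exact setLIntegral_mono' (measurableSet_extIoo _ _) fun y hy =>
        (hgk k y (extIoo_mono le_rfl ht.2.le hy)).ge
    have h3 := hC g hgm.aemeasurable
    calc (∑' k, (b k * l k) ^ r) ^ (1 / r)
        ≤ (∑' k : Z, (2 ^ ((k : ℝ) / r) * hardyNorm q w (x k) (x (k + 1)) g) ^ r) ^ (1 / r) := by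
          refine ENNReal.rpow_le_rpow (ENNReal.tsum_le_tsum fun k =>
            ENNReal.rpow_le_rpow ?_ hr.le) (by positivity)
          calc b k * l k
              ≤ b k * (2 ^ ((k : ℝ) / r) * hardyNorm q w (x k) (x (k + 1)) (h k)) :=
                mul_le_mul_right (h2 k) _
            _ = 2 ^ ((k : ℝ) / r) * (b k * hardyNorm q w (x k) (x (k + 1)) (h k)) := by ring
            _ ≤ _ := mul_le_mul_right (hH k) _
      _ ≤ C * (∑' k : Z, intE (fun t => g t ^ p * v t) (x k) (x (k + 1))) ^ (1 / p) := h3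
      _ ≤ C * 1 := by
          gcongr
          exact ENNReal.rpow_le_one ((ENNReal.tsum_le_tsum hN).trans hb) (by positivity)
      _ = C := mul_one C
  rw [gapNorm_const_mul hp0 hr] at key
  rw [ENNReal.mul_inv (Or.inr (by norm_num)) (Or.inr (by norm_num)), mul_right_comm, mul_comm,
    ENNReal.inv_mul_le_iff (by norm_num) (by norm_num)]
  exact key

end Covering

/-- Both parts of the lemma at once, with `A` given as the gap norm of the Hardy constants; the
constants `c₁, c₂` depend on `q` only. -/
theorem exists_discreteIneq_iff_and_bestConst_equiv {p q r : ℝ} (hp : 1 ≤ p) (hq : 0 < q)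
    (hr : 0 < r) : ∃ c₁ c₂ : ℝ≥0, 0 < c₁ ∧ 0 < c₂ ∧
      ∀ u v w : ℝ → ℝ≥0∞, IsWeight u → IsWeight v → IsWeight w →
      ∀ (Z : Set ℤ) (x : ℤ → EReal), IsCoveringSequence u Z x → ∀ A : ℝ≥0∞,
        A = gapNorm p r
          (fun k : Z => 2 ^ ((k : ℝ) / r) * hardyConst p q v w (x k) (x (k + 1))) →
        ((∃ C : ℝ≥0, DiscreteIneq p q r v w Z x (C : ℝ≥0∞)) ↔ A < ⊤) ∧
        (c₁ : ℝ≥0∞) * A ≤ bestConst p q r v w Z x ∧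
        bestConst p q r v w Z x ≤ (c₂ : ℝ≥0∞) * A := by
  have e1 : (((4 ^ (1 / q) * 2 * 2)⁻¹ : ℝ≥0) : ℝ≥0∞) = (4 ^ (1 / q) * 2 * 2)⁻¹ := by
    rw [ENNReal.coe_inv (by positivity), ENNReal.coe_mul, ENNReal.coe_mul,
      ENNReal.coe_rpow_of_nonneg _ (by positivity)]
    norm_num
  have e2 : ((4 * 2 ^ (1 / q) : ℝ≥0) : ℝ≥0∞) = 4 * 2 ^ (1 / q) := by
    rw [ENNReal.coe_mul, ENNReal.coe_rpow_of_nonneg _ (by positivity)]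
    norm_num
  refine ⟨(4 ^ (1 / q) * 2 * 2)⁻¹, 4 * 2 ^ (1 / q), by positivity, by positivity, ?_⟩
  rintro u v w - hv hw Z x hx A rfl
  have h1 := gapNorm_le_bestConst hp hq hr hv hw hx
  have h2 := bestConst_le hp hq hr hv hw hx
  rw [← e1] at h1
  rw [← e2] at h2
  refine ⟨⟨fun ⟨C, hC⟩ => ?_, fun hA => ?_⟩, h1, h2⟩
  · have h3 := h1.trans (sInf_le hC)
    refine lt_top_iff_ne_top.2 fun hA => ?_
    rw [hA, ENNReal.mul_top] at h3
    · exact ENNReal.coe_ne_top (top_le_iff.1 h3)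
    · exact ENNReal.coe_ne_zero.2 (by positivity)
  · obtain ⟨C, hC, hCt⟩ := sInf_lt_iff.1 (h2.trans_lt (ENNReal.mul_lt_top ENNReal.coe_lt_top hA))
    exact ⟨C.toNNReal, by rwa [ENNReal.coe_toNNReal hCt.ne]⟩

theorem lemma5p1 (p q r : ℝ) (hp : 1 ≤ p) (hq : 0 < q) (hr : 0 < r) :
    (p ≤ q → ∃ c₁ c₂ : ℝ≥0, 0 < c₁ ∧ 0 < c₂ ∧
      ∀ u v w : ℝ → ℝ≥0∞, IsWeight u → IsWeight v → IsWeight w →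
      ∀ (Z : Set ℤ) (x : ℤ → EReal), IsCoveringSequence u Z x →
        ((∃ C : ℝ≥0, DiscreteIneq p q r v w Z x (C : ℝ≥0∞)) ↔
          constA1 p q r v w Z x < ⊤) ∧
        (c₁ : ℝ≥0∞) * constA1 p q r v w Z x ≤ bestConst p q r v w Z x ∧
        bestConst p q r v w Z x ≤ (c₂ : ℝ≥0∞) * constA1 p q r v w Z x) ∧
    (q < p → ∃ c₁ c₂ : ℝ≥0, 0 < c₁ ∧ 0 < c₂ ∧
      ∀ u v w : ℝ → ℝ≥0∞, IsWeight u → IsWeight v → IsWeight w →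
      ∀ (Z : Set ℤ) (x : ℤ → EReal), IsCoveringSequence u Z x →
        ((∃ C : ℝ≥0, DiscreteIneq p q r v w Z x (C : ℝ≥0∞)) ↔
          constA2 p q r v w Z x < ⊤) ∧
        (c₁ : ℝ≥0∞) * constA2 p q r v w Z x ≤ bestConst p q r v w Z x ∧
        bestConst p q r v w Z x ≤ (c₂ : ℝ≥0∞) * constA2 p q r v w Z x) := by
  have hp0 : 0 < p := by linarith
  obtain ⟨c₁, c₂, h₁, h₂, H⟩ := exists_discreteIneq_iff_and_bestConst_equiv hp hq hr
  refine ⟨fun hpq => ⟨c₁, c₂, h₁, h₂, fun u v w hu hv hw Z x hx =>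
    H u v w hu hv hw Z x hx _ ?_⟩, fun hpq => ⟨c₁, c₂, h₁, h₂, fun u v w hu hv hw Z x hx =>
    H u v w hu hv hw Z x hx _ ?_⟩⟩
  · simp only [constA1, ellNorm_rhoExp hp0 hr, hardyConst, if_pos hpq]
  · simp only [constA2, ellNorm_rhoExp hp0 hr, hardyConst, if_neg (not_le.2 hpq)]
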